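/- Let $d\ge 3$ be an integer and $1<p<\frac{d+2}{d-2}$; put $2^*=\frac{2d}{d-2}$. All functions are complex-valued on $\mathbb{R}^d$, functions that agree almost everywhere are identified, and $\dot H^1(\mathbb{R}^d)$ denotes the space of $u\in L^{2^*}(\mathbb{R}^d)$ whose weak gradient is in $L^2$. For $\omega>0$ and $u\in H^1(\mathbb{R}^d)$ let $$\mathcal S_\omega(u)=\tfrac12\|\nabla u\|_{L^2}^2+\tfrac{\omega}{2}\|u\|_{L^2}^2-\tfrac1{p+1}\|u\|_{L^{p+1}}^{p+1}-\tfrac{d-2}{2d}\|u\|_{L^{2^*}}^{2^*},$$ $$\mathcal N_\omega(u)=\|\nabla u\|_{L^2}^2+\omega\|u\|_{L^2}^2-\|u\|_{L^{p+1}}^{p+1}-\|u\|_{L^{2^*}}^{2^*},$$ $$m_\omega^{\mathcal N}=\inf\{\mathcal S_\omega(u): u\in H^1(\mathbb{R}^d)\setminus\{0\},\ \mathcal N_\omega(u)=0\}.$$ Let further $$m_\infty=\inf\Big\{\tfrac12\|\nabla u\|_{L^2}^2-\tfrac{d-2}{2d}\|u\|_{L^{2^*}}^{2^*}: u\in\dot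 H^1(\mathbb{R}^d)\setminus\{0\},\ \|\nabla u\|_{L^2}^2=\|u\|_{L^{2^*}}^{2^*}\Big\},$$ $$\sigma=\inf\{\|\nabla u\|_{L^2}^2: u\in\dot H^1(\mathbb{R}^d),\ \|u\|_{L^{2^*}}=1\}.$$ Then $m_\infty=\sigma^{d/2}/d$, and for every $\omega>0$ with $m_\omega^{\mathcal N}<m_\infty$ a minimizer for $m_\omega^{\mathcal N}$ exists, that is, there is $u\in H^1(\mathbb{R}^d)\setminus\{0\}$ with $\mathcal N_\omega(u)=0$ and $\mathcal S_\omega(u)=m_\omega^{\mathcal N}$. -/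

import Mathlib

open MeasureTheory

noncomputable section

namespace CriticalScalarField

/-- `g` is a weak gradient of the complex-valued function `u` on `ℝ^d`: both are locally integrable
and `∫ (∂_i φ) u = - ∫ φ g_i` for every `i` and every test function `φ ∈ C_c^∞(ℝ^d)`. (Real-valued
test functions suffice, by linearity.) -/
def HasWeakGradient {d : ℕ} (u : EuclideanSpace ℝ (Fin d) → ℂ)
    (g : EuclideanSpace ℝ (Fin d) → EuclideanSpace ℂ (Fin d)) : Prop :=
  LocallyIntegrable u ∧ LocallyIntegrable g ∧
    ∀ φ : EuclideanSpace ℝ (Fin d) → ℝ, ContDiff ℝ ((⊤ : ℕ∞) : WithTop ℕ∞) φ → HasCompactSupport φ →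
      ∀ i : Fin d,
        ∫ x, (fderiv ℝ φ x (EuclideanSpace.single i 1)) • u x = - ∫ x, φ x • g x i

/-- Weak gradients are unique up to a null set. -/
theorem HasWeakGradient.ae_eq {d : ℕ} {u : EuclideanSpace ℝ (Fin d) → ℂ}
    {g h : EuclideanSpace ℝ (Fin d) → EuclideanSpace ℂ (Fin d)}
    (hg : HasWeakGradient u g) (hh : HasWeakGradient u h) : g =ᵐ[volume] h := by
  have coord : ∀ {k : EuclideanSpace ℝ (Fin d) → EuclideanSpace ℂ (Fin d)},
      LocallyIntegrable k → ∀ i, LocallyIntegrable (fun x => k x i) := by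
    intro k hk i x
    obtain ⟨s, hs, hks⟩ := hk x
    exact ⟨s, hs, (EuclideanSpace.proj (𝕜 := ℂ) i).integrable_comp hks⟩
  have key : ∀ i : Fin d, ∀ᵐ x, g x i = h x i := fun i =>
    ae_eq_of_integral_contDiff_smul_eq (coord hg.2.1 i) (coord hh.2.1 i) fun φ hφ hc => by
      have h1 := hg.2.2 φ hφ hc i
      have h2 := hh.2.2 φ hφ hc i
      exact neg_injective (h1.symm.trans h2)
  filter_upwards [ae_all_iff.2 key] with x hx
  ext i
  exact hx i

open Classical in
/-- The weak gradient `∇u` (well defined up to a null set by `HasWeakGradient.ae_eq`); it is `0` by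
convention if `u` has no weak gradient. -/
def weakGrad {d : ℕ} (u : EuclideanSpace ℝ (Fin d) → ℂ) :
    EuclideanSpace ℝ (Fin d) → EuclideanSpace ℂ (Fin d) :=
  if h : ∃ g, HasWeakGradient u g then h.choose else 0

/-- Any weak gradient of `u` agrees almost everywhere with `weakGrad u`. -/
theorem HasWeakGradient.weakGrad_ae_eq {d : ℕ} {u : EuclideanSpace ℝ (Fin d) → ℂ}
    {g : EuclideanSpace ℝ (Fin d) → EuclideanSpace ℂ (Fin d)} (hg : HasWeakGradient u g) :
    weakGrad u =ᵐ[volume] g := by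
  have h : ∃ g, HasWeakGradient u g := ⟨g, hg⟩
  have e : weakGrad u = h.choose := dif_pos h
  rw [e]
  exact h.choose_spec.ae_eq hg

/-- The Sobolev exponent `2d/(d-2)`. -/
def critExp (d : ℕ) : ℝ := 2 * (d : ℝ) / ((d : ℝ) - 2)

/-- The `L^q` norm on `ℝ^d`, for a real exponent `q > 0`. -/
def normL {d : ℕ} (q : ℝ) (u : EuclideanSpace ℝ (Fin d) → ℂ) : ℝ :=
  lpNorm u (ENNReal.ofReal q) volume

/-- The `L^2` norm `‖∇u‖_{L^2}` of the weak gradient. -/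
def gradNorm {d : ℕ} (u : EuclideanSpace ℝ (Fin d) → ℂ) : ℝ :=
  lpNorm (weakGrad u) 2 volume

/-- `u ∈ H^1(ℝ^d)`: `u` is in `L^2` and has a weak gradient in `L^2`. -/
def MemH1 {d : ℕ} (u : EuclideanSpace ℝ (Fin d) → ℂ) : Prop :=
  MemLp u 2 ∧ ∃ g, HasWeakGradient u g ∧ MemLp g 2

/-- `u ∈ Ḣ^1(ℝ^d)`, `d ≥ 3`: `u` is in `L^{2d/(d-2)}` and has a weak gradient in `L^2`. -/
def MemDotH1 {d : ℕ} (u : EuclideanSpace ℝ (Fin d) → ℂ) : Prop :=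
  MemLp u (ENNReal.ofReal (critExp d)) ∧ ∃ g, HasWeakGradient u g ∧ MemLp g 2

/-- The action `S_ω`. On `H^1(ℝ^d)` all the norms are finite by Sobolev's embedding. -/
def action {d : ℕ} (p ω : ℝ) (u : EuclideanSpace ℝ (Fin d) → ℂ) : ℝ :=
  1 / 2 * gradNorm u ^ 2 + ω / 2 * normL 2 u ^ 2 - 1 / (p + 1) * normL (p + 1) u ^ (p + 1)
    - ((d : ℝ) - 2) / (2 * d) * normL (critExp d) u ^ critExp d

/-- Nehari's functional `N_ω`. -/
def nehari {d : ℕ} (p ω : ℝ) (u : EuclideanSpace ℝ (Fin d) → ℂ) : ℝ :=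
  gradNorm u ^ 2 + ω * normL 2 u ^ 2 - normL (p + 1) u ^ (p + 1)
    - normL (critExp d) u ^ critExp d

/-- The admissible functions for `m_ω^N`: `u ∈ H^1(ℝ^d) \ {0}` with `N_ω(u) = 0`. -/
def nehariSet (d : ℕ) (p ω : ℝ) : Set (EuclideanSpace ℝ (Fin d) → ℂ) :=
  {u | MemH1 u ∧ ¬ (u =ᵐ[volume] 0) ∧ nehari p ω u = 0}

/-- The value `m_ω^N`. -/
def mNehari (d : ℕ) (p ω : ℝ) : ℝ := sInf (action p ω '' nehariSet d p ω)

/-- A ground state, that is, a minimizer for `m_ω^N`. -/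
def IsGroundState {d : ℕ} (p ω : ℝ) (u : EuclideanSpace ℝ (Fin d) → ℂ) : Prop :=
  u ∈ nehariSet d p ω ∧ action p ω u = mNehari d p ω

/-- The functional `H^‡`. -/
def critAction {d : ℕ} (u : EuclideanSpace ℝ (Fin d) → ℂ) : ℝ :=
  1 / 2 * gradNorm u ^ 2 - ((d : ℝ) - 2) / (2 * d) * normL (critExp d) u ^ critExp d

/-- The functional `N^‡`. -/
def critNehari {d : ℕ} (u : EuclideanSpace ℝ (Fin d) → ℂ) : ℝ :=
  gradNorm u ^ 2 - normL (critExp d) u ^ critExp d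

/-- The admissible functions for `m_∞`: `u ∈ Ḣ^1(ℝ^d) \ {0}` with `N^‡(u) = 0`. -/
def critNehariSet (d : ℕ) : Set (EuclideanSpace ℝ (Fin d) → ℂ) :=
  {u | MemDotH1 u ∧ ¬ (u =ᵐ[volume] 0) ∧ critNehari u = 0}

/-- The value `m_∞`. -/
def mInfty (d : ℕ) : ℝ := sInf (critAction '' critNehariSet d)

/-- The sharp Sobolev constant `σ`. -/
def sobolevConst (d : ℕ) : ℝ :=
  sInf ((fun u : EuclideanSpace ℝ (Fin d) → ℂ => gradNorm u ^ 2) ''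
    {u | MemDotH1 u ∧ normL (critExp d) u = 1})

/-- The action is nonnegative on the admissible set, so the infimum `m_ω^N` is a genuine one. -/
theorem bddBelow_action {d : ℕ} (hd : 3 ≤ d) {p : ℝ} (hp : 1 < p) (ω : ℝ) :
    BddBelow (action p ω '' nehariSet d p ω) := by
  refine ⟨0, ?_⟩
  rintro _ ⟨u, ⟨-, -, hu⟩, rfl⟩
  have hd' : (3 : ℝ) ≤ d := by exact_mod_cast hd
  have h1 : 0 ≤ normL (p + 1) u ^ (p + 1) := Real.rpow_nonneg lpNorm_nonneg _
  have h2 : 0 ≤ normL (critExp d) u ^ critExp d := Real.rpow_nonneg lpNorm_nonneg _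
  have e1 : 1 / (p + 1) ≤ 1 / 2 := by
    apply one_div_le_one_div_of_le <;> linarith
  have e2 : ((d : ℝ) - 2) / (2 * d) ≤ 1 / 2 := by
    rw [div_le_div_iff₀ (by linarith) (by norm_num)]; linarith
  unfold nehari at hu
  unfold action
  nlinarith [mul_nonneg (sub_nonneg.2 e1) h1, mul_nonneg (sub_nonneg.2 e2) h2]

/-- `H^‡` is nonnegative on the admissible set, so the infimum `m_∞` is a genuine one. -/
theorem bddBelow_critAction {d : ℕ} (hd : 3 ≤ d) :
    BddBelow (critAction '' critNehariSet d) := by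
  refine ⟨0, ?_⟩
  rintro _ ⟨u, ⟨-, -, hu⟩, rfl⟩
  have hd' : (3 : ℝ) ≤ d := by exact_mod_cast hd
  have h2 : 0 ≤ normL (critExp d) u ^ critExp d := Real.rpow_nonneg lpNorm_nonneg _
  have e2 : ((d : ℝ) - 2) / (2 * d) ≤ 1 / 2 := by
    rw [div_le_div_iff₀ (by linarith) (by norm_num)]; linarith
  unfold critNehari at hu
  unfold critAction
  nlinarith [mul_nonneg (sub_nonneg.2 e2) h2]

end CriticalScalarField

end

/-!
# Ground states below the critical level

The value of `m_∞` comes from scaling alone: a function of unit `L^{2d/(d-2)}` norm has exactly one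
positive multiple satisfying `N^‡ = 0`, and its critical action is `‖∇u‖^d / d`. The only point to
check is that the gradient of a unit function does not vanish, which holds because a function with
zero weak gradient is constant.

For the existence of a minimizer, on the Nehari set the action equals the `reducedAction`, which
contains only the two nonlinear terms. Functions with `N_ω < 0` have to be shrunk to reach that
set, so their reduced action exceeds `m_ω` (`mNehari_lt_reducedAction`). A minimizing sequence is
bounded in `H^1`, and `m_ω < m_∞` prevents its `L^{p+1}` norms from tending to zero
(`exists_frequently_normL_ge`): otherwise it would asymptotically satisfy the constraint of the
critical problem, and the Sobolev inequality with constant `σ` would give `m_ω ≥ m_∞`. By Lions'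
lemma (`exists_lions`) the sequence then carries local `L^2` masses bounded below, which are
translated to the origin; Rellich's theorem (`tendsto_lintegral_sq_of_weakTendsto`) shows that a
subsequence converges, weakly in `H^1` and almost everywhere, to some `v ≠ 0`.

The quadratic terms split by weak convergence and the nonlinear ones by the Brezis–Lieb lemma
(`tendsto_integral_rpow_sub_of_ae`), so that `N_ω(v_n - v) → -N_ω(v)`, and the reduced action of
`v_n - v` tends to `m_ω` minus that of `v`. If `N_ω(v) > 0`, the remainders have `N_ω < 0` for large
`n`, hence reduced action at least `m_ω`, and the reduced action of `v` would be nonpositive, which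
is absurd. So `N_ω(v) ≤ 0`, the reduced action of `v` is at most `m_ω`, and `v` is a minimizer
(`isGroundState_of_weak_limit`).

Weak gradients are handled by mollification: the mollified function has the mollified weak gradient
as classical gradient (`HasWeakGradient.fderiv_smear`). This yields the embedding of `H^1` into
`L^{2d/(d-2)}` from the inequality for test functions (`exists_sobolev`), and the translation
estimate behind Rellich's theorem.
-/

noncomputable section

namespace CriticalScalarField

open Filter Topology
open scoped ENNReal NNReal

/-! ### Calculus of weak gradients -/

theorem locallyIntegrable_apply {d : ℕ} {g : EuclideanSpace ℝ (Fin d) → EuclideanSpace ℂ (Fin d)}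
    (hg : LocallyIntegrable g) (i : Fin d) : LocallyIntegrable (fun x => g x i) := by
  intro x
  obtain ⟨s, hs, hks⟩ := hg x
  exact ⟨s, hs, (EuclideanSpace.proj (𝕜 := ℂ) i).integrable_comp hks⟩

theorem continuous_fderiv_test {d : ℕ} {φ : EuclideanSpace ℝ (Fin d) → ℝ}
    (hφ : ContDiff ℝ ((⊤ : ℕ∞) : WithTop ℕ∞) φ) (v : EuclideanSpace ℝ (Fin d)) :
    Continuous (fun x => fderiv ℝ φ x v) :=
  (hφ.continuous_fderiv (by simp)).clm_apply continuous_const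

theorem hasCompactSupport_fderiv_test {d : ℕ} {φ : EuclideanSpace ℝ (Fin d) → ℝ}
    (hc : HasCompactSupport φ) (v : EuclideanSpace ℝ (Fin d)) :
    HasCompactSupport (fun x => fderiv ℝ φ x v) :=
  hc.fderiv_apply (𝕜 := ℝ) v

theorem HasWeakGradient.add {d : ℕ} {u v : EuclideanSpace ℝ (Fin d) → ℂ}
    {g h : EuclideanSpace ℝ (Fin d) → EuclideanSpace ℂ (Fin d)}
    (hu : HasWeakGradient u g) (hv : HasWeakGradient v h) :
    HasWeakGradient (fun x => u x + v x) (fun x => g x + h x) := by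
  refine ⟨hu.1.add hv.1, hu.2.1.add hv.2.1, fun φ hφ hc i => ?_⟩
  have c1 := continuous_fderiv_test hφ (EuclideanSpace.single i 1)
  have c2 := hasCompactSupport_fderiv_test hc (EuclideanSpace.single i 1)
  have e := hu.2.2 φ hφ hc i
  have e' := hv.2.2 φ hφ hc i
  simp only [smul_add, PiLp.add_apply]
  rw [integral_add (hu.1.integrable_smul_left_of_hasCompactSupport c1 c2)
      (hv.1.integrable_smul_left_of_hasCompactSupport c1 c2),
    integral_add ((locallyIntegrable_apply hu.2.1 i).integrable_smul_left_of_hasCompactSupport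
      hφ.continuous hc)
      ((locallyIntegrable_apply hv.2.1 i).integrable_smul_left_of_hasCompactSupport
      hφ.continuous hc), e, e', neg_add]

theorem HasWeakGradient.const_smul {d : ℕ} {u : EuclideanSpace ℝ (Fin d) → ℂ}
    {g : EuclideanSpace ℝ (Fin d) → EuclideanSpace ℂ (Fin d)}
    (hu : HasWeakGradient u g) (c : ℝ) :
    HasWeakGradient (fun x => c • u x) (fun x => c • g x) := by
  refine ⟨hu.1.smul c, hu.2.1.smul c, fun φ hφ hc i => ?_⟩
  have e := hu.2.2 φ hφ hc i
  simp only [PiLp.smul_apply]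
  simp_rw [smul_comm _ c]
  rw [integral_smul, integral_smul, e, smul_neg]

theorem HasWeakGradient.sub {d : ℕ} {u v : EuclideanSpace ℝ (Fin d) → ℂ}
    {g h : EuclideanSpace ℝ (Fin d) → EuclideanSpace ℂ (Fin d)}
    (hu : HasWeakGradient u g) (hv : HasWeakGradient v h) :
    HasWeakGradient (fun x => u x - v x) (fun x => g x - h x) := by
  simpa [sub_eq_add_neg] using hu.add (hv.const_smul (-1))

theorem _root_.MeasureTheory.LocallyIntegrable.comp_add_right_euclidean {d : ℕ} {F : Type*}
    [NormedAddCommGroup F]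
    {f : EuclideanSpace ℝ (Fin d) → F} (hf : LocallyIntegrable f) (y : EuclideanSpace ℝ (Fin d)) :
    LocallyIntegrable (fun x => f (x + y)) := by
  intro x
  obtain ⟨s, hs, hfs⟩ := hf (x + y)
  refine ⟨(fun x => x + y) ⁻¹' s, (continuous_add_const y).continuousAt.preimage_mem_nhds hs, ?_⟩
  exact ((measurePreserving_add_right volume y).integrableOn_comp_preimage
    (MeasurableEquiv.addRight y).measurableEmbedding).2 hfs

theorem HasWeakGradient.comp_add_right {d : ℕ} {u : EuclideanSpace ℝ (Fin d) → ℂ}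
    {g : EuclideanSpace ℝ (Fin d) → EuclideanSpace ℂ (Fin d)}
    (hu : HasWeakGradient u g) (y : EuclideanSpace ℝ (Fin d)) :
    HasWeakGradient (fun x => u (x + y)) (fun x => g (x + y)) := by
  refine ⟨hu.1.comp_add_right_euclidean y, hu.2.1.comp_add_right_euclidean y,
    fun φ hφ hc i => ?_⟩
  have e := hu.2.2 (fun x => φ (x - y)) (hφ.comp (contDiff_id.sub contDiff_const))
    (hc.comp_homeomorph (Homeomorph.subRight y)) i
  rw [← integral_add_right_eq_self _ y, ← integral_add_right_eq_self (fun x => φ (x - y) • g x i) y]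
    at e
  simpa [fderiv_comp_sub] using e

/-- The classical gradient of a real function, as a complex vector field. -/
def realGrad {d : ℕ} (χ : EuclideanSpace ℝ (Fin d) → ℝ) (x : EuclideanSpace ℝ (Fin d)) :
    EuclideanSpace ℂ (Fin d) :=
  WithLp.toLp 2 (fun i => ((fderiv ℝ χ x (EuclideanSpace.single i 1) : ℝ) : ℂ))

theorem continuous_realGrad {d : ℕ} {χ : EuclideanSpace ℝ (Fin d) → ℝ}
    (hχ : ContDiff ℝ ((⊤ : ℕ∞) : WithTop ℕ∞) χ) : Continuous (realGrad χ) := by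
  refine (PiLp.continuous_toLp 2 _).comp (continuous_pi fun i => ?_)
  exact Complex.continuous_ofReal.comp (continuous_fderiv_test hχ _)

theorem hasCompactSupport_realGrad {d : ℕ} {χ : EuclideanSpace ℝ (Fin d) → ℝ}
    (hc : HasCompactSupport χ) : HasCompactSupport (realGrad χ) := by
  refine (hc.fderiv (𝕜 := ℝ)).mono fun x hx => ?_
  contrapose! hx
  simp only [Function.mem_support, not_not] at hx ⊢
  ext i
  simp [realGrad, hx]

/-- The product rule for a smooth factor. -/
theorem HasWeakGradient.smul_smooth {d : ℕ} {u : EuclideanSpace ℝ (Fin d) → ℂ}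
    {g : EuclideanSpace ℝ (Fin d) → EuclideanSpace ℂ (Fin d)}
    (hu : HasWeakGradient u g) {χ : EuclideanSpace ℝ (Fin d) → ℝ}
    (hχ : ContDiff ℝ ((⊤ : ℕ∞) : WithTop ℕ∞) χ) :
    HasWeakGradient (fun x => χ x • u x) (fun x => χ x • g x + u x • realGrad χ x) := by
  have l1 : LocallyIntegrable (fun x => χ x • u x) := hu.1.continuous_smul hχ.continuous
  have l2 : LocallyIntegrable (fun x => χ x • g x + u x • realGrad χ x) :=
    (hu.2.1.continuous_smul hχ.continuous).add (hu.1.smul_continuous (continuous_realGrad hχ))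
  refine ⟨l1, l2, fun φ hφ hc i => ?_⟩
  have e := hu.2.2 (fun x => χ x * φ x) (hχ.mul hφ) hc.mul_left i
  have hd : ∀ x, fderiv ℝ (fun x => χ x * φ x) x (EuclideanSpace.single i 1) =
      χ x * fderiv ℝ φ x (EuclideanSpace.single i 1)
        + φ x * fderiv ℝ χ x (EuclideanSpace.single i 1) := fun x => by
    rw [fderiv_fun_mul (hχ.differentiable (by simp) x) (hφ.differentiable (by simp) x)]
    simp
  have c1 := continuous_fderiv_test hφ (EuclideanSpace.single i 1)
  have s1 := hasCompactSupport_fderiv_test hc (EuclideanSpace.single i 1)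
  have c2 := continuous_fderiv_test hχ (EuclideanSpace.single i 1)
  have i1 : Integrable (fun x => (χ x * fderiv ℝ φ x (EuclideanSpace.single i 1)) • u x) :=
    hu.1.integrable_smul_left_of_hasCompactSupport (hχ.continuous.mul c1) s1.mul_left
  have i2 : Integrable (fun x => (φ x * fderiv ℝ χ x (EuclideanSpace.single i 1)) • u x) :=
    hu.1.integrable_smul_left_of_hasCompactSupport (hφ.continuous.mul c2) hc.mul_right
  have i3 : Integrable (fun x => (χ x * φ x) • g x i) :=
    (locallyIntegrable_apply hu.2.1 i).integrable_smul_left_of_hasCompactSupport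
      (hχ.continuous.mul hφ.continuous) hc.mul_left
  simp_rw [hd, add_smul] at e
  rw [integral_add i1 i2] at e
  have e2 : ∫ x, φ x • (χ x • g x + u x • realGrad χ x) i
      = ∫ x, (χ x * φ x) • g x i
        + (φ x * fderiv ℝ χ x (EuclideanSpace.single i 1)) • u x := by
    congr 1
    ext x
    simp [realGrad]
    ring
  rw [e2, integral_add i3 i2, neg_add, ← e]
  simp [mul_comm, mul_assoc]

theorem hasWeakGradient_one {d : ℕ} :
    HasWeakGradient (fun _ : EuclideanSpace ℝ (Fin d) => (1 : ℂ)) (fun _ => 0) := by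
  refine ⟨locallyIntegrable_const _, locallyIntegrable_const _, fun φ hφ hc i => ?_⟩
  have c1 := continuous_fderiv_test hφ (EuclideanSpace.single i 1)
  have s1 := hasCompactSupport_fderiv_test hc (EuclideanSpace.single i 1)
  have := integral_mul_fderiv_eq_neg_fderiv_mul_of_integrable (μ := volume)
    (f := fun _ : EuclideanSpace ℝ (Fin d) => (1 : ℝ)) (g := φ) (v := EuclideanSpace.single i 1)
    (by simp) (by simpa using c1.integrable_of_hasCompactSupport s1)
    (by simpa using hφ.continuous.integrable_of_hasCompactSupport hc)
    (fun x _ => differentiableAt_const _) (fun x _ => hφ.differentiable (by simp) x)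
  rw [integral_smul_const]
  simp at this
  simp [this]

theorem hasWeakGradient_smooth {d : ℕ} {χ : EuclideanSpace ℝ (Fin d) → ℝ}
    (hχ : ContDiff ℝ ((⊤ : ℕ∞) : WithTop ℕ∞) χ) :
    HasWeakGradient (fun x => (χ x : ℂ)) (realGrad χ) := by
  simpa using hasWeakGradient_one.smul_smooth hχ

/-- A fixed radial bump function on `ℝ^d`, equal to `1` on the unit ball and supported in the ball
of radius `2`. -/
def unitBump (d : ℕ) : ContDiffBump (0 : EuclideanSpace ℝ (Fin d)) := ⟨1, 2, one_pos, one_lt_two⟩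

/-! ### Averages and mollification -/

theorem eLpNorm_two_sq {α F : Type*} [MeasurableSpace α] [NormedAddCommGroup F] {μ : Measure α}
    (f : α → F) : eLpNorm f 2 μ ^ 2 = ∫⁻ x, ‖f x‖ₑ ^ 2 ∂μ := by
  have := eLpNorm_nnreal_pow_eq_lintegral (f := f) (μ := μ) (p := 2) (by norm_num)
  simpa using this

theorem le_of_sq_le_sq {a b : ℝ≥0∞} (h : a ^ 2 ≤ b ^ 2) : a ≤ b :=
  (ENNReal.pow_le_pow_left_iff two_ne_zero).1 h

/-- The square of the `L^2` norm of an average `∫ ρ(t) h(·, t) dt` is at most the largest of the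
squared `L^2` norms of the `h(·, t)`: Cauchy–Schwarz in `t`, then Tonelli. -/
theorem lintegral_sq_average_le {X T F : Type*} [MeasurableSpace X] [MeasurableSpace T]
    [NormedAddCommGroup F] [NormedSpace ℝ F] {μ : Measure X} {ν : Measure T} [SFinite μ]
    [SFinite ν] {ρ : T → ℝ} (hρ : Measurable ρ) (hρ0 : ∀ t, 0 ≤ ρ t)
    (hρ1 : ∫⁻ t, ENNReal.ofReal (ρ t) ∂ν ≤ 1) {h : X → T → F}
    (hm : AEStronglyMeasurable (Function.uncurry h) (μ.prod ν)) {B : ℝ≥0∞}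
    (hB : ∀ᵐ t ∂ν, ρ t ≠ 0 → ∫⁻ x, ‖h x t‖ₑ ^ 2 ∂μ ≤ B) :
    ∫⁻ x, ‖∫ t, ρ t • h x t ∂ν‖ₑ ^ 2 ∂μ ≤ B := by
  have hmρ : Measurable fun t => ENNReal.ofReal (ρ t) := hρ.ennreal_ofReal
  have step : ∀ᵐ x ∂μ, ‖∫ t, ρ t • h x t ∂ν‖ₑ ^ 2
      ≤ ∫⁻ t, ENNReal.ofReal (ρ t) * ‖h x t‖ₑ ^ 2 ∂ν := by
    filter_upwards [hm.prodMk_left] with x hx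
    have hx' : AEStronglyMeasurable (fun t => h x t) ν := hx
    have h1 : ‖∫ t, ρ t • h x t ∂ν‖ₑ ≤ ∫⁻ t, ENNReal.ofReal (ρ t) * ‖h x t‖ₑ ∂ν := by
      refine (enorm_integral_le_lintegral_enorm _).trans (le_of_eq ?_)
      congr 1
      ext t
      rw [enorm_smul, Real.enorm_of_nonneg (hρ0 t)]
    have h2 := ENNReal.lintegral_mul_norm_pow_le (μ := ν) (f := fun t => ENNReal.ofReal (ρ t))
      (g := fun t => ENNReal.ofReal (ρ t) * ‖h x t‖ₑ ^ 2) hmρ.aemeasurable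
      (hmρ.aemeasurable.mul (hx'.enorm.pow_const 2)) (p := 1 / 2) (q := 1 / 2)
      (by norm_num) (by norm_num) (by norm_num)
    have h3 : ∀ t, ENNReal.ofReal (ρ t) ^ (1 / 2 : ℝ)
        * (ENNReal.ofReal (ρ t) * ‖h x t‖ₑ ^ 2) ^ (1 / 2 : ℝ)
        = ENNReal.ofReal (ρ t) * ‖h x t‖ₑ := fun t => by
      rw [ENNReal.mul_rpow_of_nonneg _ _ (by norm_num), ← mul_assoc,
        ← ENNReal.rpow_add_of_nonneg _ _ (by norm_num) (by norm_num), ← ENNReal.rpow_natCast,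
        ← ENNReal.rpow_mul]
      norm_num
    simp_rw [h3] at h2
    have h4 : ∫⁻ t, ENNReal.ofReal (ρ t) * ‖h x t‖ₑ ∂ν
        ≤ (∫⁻ t, ENNReal.ofReal (ρ t) * ‖h x t‖ₑ ^ 2 ∂ν) ^ (1 / 2 : ℝ) := by
      refine h2.trans ?_
      calc _ ≤ 1 ^ (1 / 2 : ℝ) * (∫⁻ t, ENNReal.ofReal (ρ t) * ‖h x t‖ₑ ^ 2 ∂ν) ^ (1 / 2 : ℝ) := by
            gcongr
        _ = _ := by simp
    calc ‖∫ t, ρ t • h x t ∂ν‖ₑ ^ 2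
        ≤ ((∫⁻ t, ENNReal.ofReal (ρ t) * ‖h x t‖ₑ ^ 2 ∂ν) ^ (1 / 2 : ℝ)) ^ 2 := by
          gcongr
          exact h1.trans h4
      _ = _ := by
        rw [← ENNReal.rpow_natCast, ← ENNReal.rpow_mul]
        norm_num
  have hm' : AEMeasurable (Function.uncurry fun x t => ENNReal.ofReal (ρ t) * ‖h x t‖ₑ ^ 2)
      (μ.prod ν) := by
    refine AEMeasurable.mul ?_ (hm.enorm.pow_const 2)
    exact (hmρ.comp measurable_snd).aemeasurable
  calc ∫⁻ x, ‖∫ t, ρ t • h x t ∂ν‖ₑ ^ 2 ∂μ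
      ≤ ∫⁻ x, ∫⁻ t, ENNReal.ofReal (ρ t) * ‖h x t‖ₑ ^ 2 ∂ν ∂μ := lintegral_mono_ae step
    _ = ∫⁻ t, ∫⁻ x, ENNReal.ofReal (ρ t) * ‖h x t‖ₑ ^ 2 ∂μ ∂ν := lintegral_lintegral_swap hm'
    _ = ∫⁻ t, ENNReal.ofReal (ρ t) * ∫⁻ x, ‖h x t‖ₑ ^ 2 ∂μ ∂ν := by
      congr 1
      ext t
      rw [lintegral_const_mul' _ _ ENNReal.ofReal_ne_top]
    _ ≤ ∫⁻ t, ENNReal.ofReal (ρ t) * B ∂ν := by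
      refine lintegral_mono_ae ?_
      filter_upwards [hB] with t ht
      by_cases h0 : ρ t = 0
      · simp [h0]
      · gcongr
        exact ht h0
    _ = (∫⁻ t, ENNReal.ofReal (ρ t) ∂ν) * B := lintegral_mul_const _ hmρ
    _ ≤ 1 * B := by gcongr
    _ = B := one_mul B

/-- The convolution `ρ * f` on `ℝ^d`. -/
def smear {d : ℕ} {F : Type*} [NormedAddCommGroup F] [NormedSpace ℝ F]
    (ρ : EuclideanSpace ℝ (Fin d) → ℝ) (f : EuclideanSpace ℝ (Fin d) → F)
    (x : EuclideanSpace ℝ (Fin d)) : F :=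
  ∫ t, ρ t • f (x - t)

theorem smear_eq_convolution {d : ℕ} {F : Type*} [NormedAddCommGroup F] [NormedSpace ℝ F]
    (ρ : EuclideanSpace ℝ (Fin d) → ℝ) (f : EuclideanSpace ℝ (Fin d) → F) :
    smear ρ f = convolution ρ f (ContinuousLinearMap.lsmul ℝ ℝ) volume := by
  ext x
  rw [convolution_lsmul]
  rfl

theorem integrable_smear {d : ℕ} {F : Type*} [NormedAddCommGroup F] [NormedSpace ℝ F]
    {ρ : EuclideanSpace ℝ (Fin d) → ℝ} (hρ : Continuous ρ) (hc : HasCompactSupport ρ)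
    {f : EuclideanSpace ℝ (Fin d) → F} (hf : LocallyIntegrable f)
    (x : EuclideanSpace ℝ (Fin d)) : Integrable (fun t => ρ t • f (x - t)) :=
  hc.convolutionExists_left (ContinuousLinearMap.lsmul ℝ ℝ) hρ hf x

theorem contDiff_smear {d : ℕ} {F : Type*} [NormedAddCommGroup F] [NormedSpace ℝ F]
    {ρ : EuclideanSpace ℝ (Fin d) → ℝ} (hρ : ContDiff ℝ ((⊤ : ℕ∞) : WithTop ℕ∞) ρ)
    (hc : HasCompactSupport ρ) {f : EuclideanSpace ℝ (Fin d) → F} (hf : LocallyIntegrable f) :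
    ContDiff ℝ ((⊤ : ℕ∞) : WithTop ℕ∞) (smear ρ f) := by
  rw [smear_eq_convolution]
  exact hc.contDiff_convolution_left _ hρ hf

/-- Mollification turns the weak gradient into a classical one. -/
theorem HasWeakGradient.fderiv_smear {d : ℕ} {u : EuclideanSpace ℝ (Fin d) → ℂ}
    {g : EuclideanSpace ℝ (Fin d) → EuclideanSpace ℂ (Fin d)} (hu : HasWeakGradient u g)
    {ρ : EuclideanSpace ℝ (Fin d) → ℝ} (hρ : ContDiff ℝ ((⊤ : ℕ∞) : WithTop ℕ∞) ρ)
    (hc : HasCompactSupport ρ) (x : EuclideanSpace ℝ (Fin d)) (i : Fin d) :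
    fderiv ℝ (smear ρ u) x (EuclideanSpace.single i 1) = smear ρ g x i := by
  set v : EuclideanSpace ℝ (Fin d) := EuclideanSpace.single i 1
  have hρ1 : ContDiff ℝ 1 ρ := hρ.of_le (by exact_mod_cast le_top)
  have h1 := hc.hasFDerivAt_convolution_left (μ := volume) (ContinuousLinearMap.lsmul ℝ ℝ) hρ1
    hu.1 x
  rw [← smear_eq_convolution] at h1
  rw [h1.fderiv]
  have hint : Integrable (fun t => (ContinuousLinearMap.precompL (EuclideanSpace ℝ (Fin d))
      (ContinuousLinearMap.lsmul ℝ ℝ : ℝ →L[ℝ] ℂ →L[ℝ] ℂ)) (fderiv ℝ ρ t) (u (x - t))) :=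
    (hc.fderiv (𝕜 := ℝ)).convolutionExists_left _ (hρ.continuous_fderiv (by simp)) hu.1 x
  rw [convolution_def, ContinuousLinearMap.integral_apply hint]
  have e1 : ∀ t, ((ContinuousLinearMap.precompL (EuclideanSpace ℝ (Fin d))
      (ContinuousLinearMap.lsmul ℝ ℝ : ℝ →L[ℝ] ℂ →L[ℝ] ℂ)) (fderiv ℝ ρ t) (u (x - t))) v
      = fderiv ℝ ρ t v • u (x - t) := fun t => by simp [ContinuousLinearMap.precompL_apply]
  simp_rw [e1]
  have hφ : ContDiff ℝ ((⊤ : ℕ∞) : WithTop ℕ∞) (fun t => ρ (x - t)) :=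
    hρ.comp (contDiff_const.sub contDiff_id)
  have hφc : HasCompactSupport (fun t => ρ (x - t)) :=
    hc.comp_homeomorph (Homeomorph.subLeft x)
  have e2 := hu.2.2 _ hφ hφc i
  have e3 : ∀ t, fderiv ℝ (fun t => ρ (x - t)) t = - fderiv ℝ ρ (x - t) := fun t => by
    have : HasFDerivAt (fun t => ρ (x - t)) _ t :=
      ((hρ.differentiable (by simp) (x - t)).hasFDerivAt).comp t ((hasFDerivAt_id t).const_sub x)
    rw [this.fderiv]
    ext w
    simp
  simp_rw [e3] at e2
  rw [← integral_sub_left_eq_self (fun t => fderiv ℝ ρ t v • u (x - t)) volume x]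
  simp only [sub_sub_cancel]
  have e4 : smear ρ g x i = ∫ t, ρ t • g (x - t) i := by
    have := ((EuclideanSpace.proj (𝕜 := ℂ) i).restrictScalars ℝ).integral_comp_comm
      (integrable_smear hρ.continuous hc hu.2.1 x)
    simpa [smear] using this.symm
  rw [e4, ← integral_sub_left_eq_self (fun t => ρ t • g (x - t) i) volume x]
  simp only [sub_sub_cancel]
  simpa [integral_neg] using e2

theorem opNorm_le_of_apply_single {d : ℕ} (L : EuclideanSpace ℝ (Fin d) →L[ℝ] ℂ)
    (G : EuclideanSpace ℂ (Fin d)) (h : ∀ i, L (EuclideanSpace.single i 1) = G i) : ‖L‖ ≤ ‖G‖ := by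
  refine L.opNorm_le_bound (norm_nonneg _) fun v => ?_
  have hv : v = ∑ i, v i • (EuclideanSpace.single i 1 : EuclideanSpace ℝ (Fin d)) := by
    have := (EuclideanSpace.basisFun (Fin d) ℝ).sum_repr v
    simpa using this.symm
  have e : L v = ∑ i, v i • G i := by
    conv_lhs => rw [hv]
    simp [map_sum, h]
  rw [e]
  calc ‖∑ i, v i • G i‖ ≤ ∑ i, ‖G i‖ * ‖v i‖ := by
        refine (norm_sum_le _ _).trans (le_of_eq ?_)
        simp [mul_comm]
    _ ≤ √(∑ i, ‖G i‖ ^ 2) * √(∑ i, ‖v i‖ ^ 2) := Real.sum_mul_le_sqrt_mul_sqrt _ _ _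
    _ = ‖G‖ * ‖v‖ := by rw [EuclideanSpace.norm_eq, EuclideanSpace.norm_eq]

theorem HasWeakGradient.norm_fderiv_smear_le {d : ℕ} {u : EuclideanSpace ℝ (Fin d) → ℂ}
    {g : EuclideanSpace ℝ (Fin d) → EuclideanSpace ℂ (Fin d)} (hu : HasWeakGradient u g)
    {ρ : EuclideanSpace ℝ (Fin d) → ℝ} (hρ : ContDiff ℝ ((⊤ : ℕ∞) : WithTop ℕ∞) ρ)
    (hc : HasCompactSupport ρ) (x : EuclideanSpace ℝ (Fin d)) :
    ‖fderiv ℝ (smear ρ u) x‖ ≤ ‖smear ρ g x‖ :=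
  opNorm_le_of_apply_single _ _ (hu.fderiv_smear hρ hc x)

/-- The standard mollifiers: bump functions of integral one, the `n`-th one supported in the ball
of radius `1 / (n + 1)`. -/
def mollifier (d n : ℕ) : EuclideanSpace ℝ (Fin d) → ℝ :=
  ContDiffBump.normed (⟨1 / (2 * ((n : ℝ) + 1)), 1 / ((n : ℝ) + 1), by positivity, by
    rw [one_div_lt_one_div (by positivity) (by positivity)]; linarith [n.cast_nonneg (α := ℝ)]⟩ :
    ContDiffBump (0 : EuclideanSpace ℝ (Fin d))) volume

theorem contDiff_mollifier (d n : ℕ) :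
    ContDiff ℝ ((⊤ : ℕ∞) : WithTop ℕ∞) (mollifier d n) := ContDiffBump.contDiff_normed _

theorem hasCompactSupport_mollifier (d n : ℕ) : HasCompactSupport (mollifier d n) :=
  ContDiffBump.hasCompactSupport_normed _

theorem mollifier_nonneg (d n : ℕ) (x : EuclideanSpace ℝ (Fin d)) : 0 ≤ mollifier d n x :=
  ContDiffBump.nonneg_normed _ x

theorem integral_mollifier (d n : ℕ) : ∫ x, mollifier d n x = 1 :=
  ContDiffBump.integral_normed _

theorem norm_lt_of_mollifier_ne_zero {d n : ℕ} {x : EuclideanSpace ℝ (Fin d)}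
    (hx : mollifier d n x ≠ 0) : ‖x‖ < 1 / ((n : ℝ) + 1) := by
  have : x ∈ Function.support (mollifier d n) := hx
  unfold mollifier at this
  rw [ContDiffBump.support_normed_eq] at this
  simpa using this

theorem ae_tendsto_smear_mollifier {d : ℕ} {F : Type*} [NormedAddCommGroup F] [NormedSpace ℝ F]
    [CompleteSpace F] {f : EuclideanSpace ℝ (Fin d) → F} (hf : LocallyIntegrable f) :
    ∀ᵐ x, Tendsto (fun n => smear (mollifier d n) f x) atTop (𝓝 (f x)) := by
  simp_rw [smear_eq_convolution]
  refine ContDiffBump.ae_convolution_tendsto_right_of_locallyIntegrable (K := 2)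
    tendsto_one_div_add_atTop_nhds_zero_nat (Eventually.of_forall fun n => le_of_eq ?_) hf
  dsimp only
  field_simp

theorem lintegral_mollifier (d n : ℕ) : ∫⁻ t, ENNReal.ofReal (mollifier d n t) = 1 := by
  rw [← ofReal_integral_eq_lintegral_ofReal
    ((contDiff_mollifier d n).continuous.integrable_of_hasCompactSupport
      (hasCompactSupport_mollifier d n))
    (Eventually.of_forall (mollifier_nonneg d n)), integral_mollifier]
  simp

theorem aestronglyMeasurable_sub_uncurry {d : ℕ} {F : Type*} [NormedAddCommGroup F]
    {f : EuclideanSpace ℝ (Fin d) → F} (hf : AEStronglyMeasurable f) :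
    AEStronglyMeasurable (fun z : EuclideanSpace ℝ (Fin d) × EuclideanSpace ℝ (Fin d) =>
      f (z.1 - z.2)) (volume.prod volume) :=
  hf.comp_quasiMeasurePreserving (quasiMeasurePreserving_sub_of_right_invariant volume volume)

theorem eLpNorm_smear_mollifier_le {d : ℕ} {F : Type*} [NormedAddCommGroup F] [NormedSpace ℝ F]
    (n : ℕ) {f : EuclideanSpace ℝ (Fin d) → F} (hf : AEStronglyMeasurable f) :
    eLpNorm (smear (mollifier d n) f) 2 ≤ eLpNorm f 2 := by
  refine le_of_sq_le_sq ?_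
  rw [eLpNorm_two_sq, eLpNorm_two_sq]
  refine lintegral_sq_average_le (h := fun x t => f (x - t))
    (contDiff_mollifier d n).continuous.measurable (mollifier_nonneg d n)
    (lintegral_mollifier d n).le (aestronglyMeasurable_sub_uncurry hf)
    (Eventually.of_forall fun t _ => le_of_eq ?_)
  exact lintegral_sub_right_eq_self (fun x => ‖f x‖ₑ ^ 2) t

/-! ### The Sobolev embedding and the translation estimate -/

theorem aestronglyMeasurable_smear {d : ℕ} {F : Type*} [NormedAddCommGroup F] [NormedSpace ℝ F]
    (n : ℕ) {f : EuclideanSpace ℝ (Fin d) → F} (hf : LocallyIntegrable f) :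
    AEStronglyMeasurable (smear (mollifier d n) f) :=
  (contDiff_smear (contDiff_mollifier d n) (hasCompactSupport_mollifier d n)
    hf).continuous.aestronglyMeasurable

/-- A function of `L^q` with vanishing weak gradient is constant, hence zero. -/
theorem HasWeakGradient.ae_eq_zero_of_grad {d : ℕ} (hd : d ≠ 0)
    {u : EuclideanSpace ℝ (Fin d) → ℂ}
    {g : EuclideanSpace ℝ (Fin d) → EuclideanSpace ℂ (Fin d)} (hu : HasWeakGradient u g)
    (hg : g =ᵐ[volume] 0) {q : ℝ≥0∞} (hq : q ≠ 0) (hq' : q ≠ ⊤) (hLq : MemLp u q) :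
    u =ᵐ[volume] 0 := by
  have hconst : ∀ n x, smear (mollifier d n) u x = smear (mollifier d n) u 0 := fun n x => by
    refine is_const_of_fderiv_eq_zero (𝕜 := ℝ)
      ((contDiff_smear (contDiff_mollifier d n) (hasCompactSupport_mollifier d n)
        hu.1).differentiable (by simp)) (fun y => ?_) x 0
    have h1 := hu.norm_fderiv_smear_le (contDiff_mollifier d n) (hasCompactSupport_mollifier d n) y
    have h2 : smear (mollifier d n) g y = 0 := by
      unfold smear
      rw [integral_eq_zero_of_ae]
      have := (Measure.measurePreserving_sub_left volume y).quasiMeasurePreserving.ae hg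
      filter_upwards [this] with t ht
      simp [ht]
    rw [h2, norm_zero] at h1
    exact norm_le_zero_iff.1 h1
  have hlim := ae_tendsto_smear_mollifier hu.1
  obtain ⟨x₀, hx₀⟩ := hlim.exists
  have hu' : u =ᵐ[volume] fun _ => u x₀ := by
    filter_upwards [hlim] with x hx
    simp_rw [hconst _ x] at hx
    simp_rw [hconst _ x₀] at hx₀
    exact tendsto_nhds_unique hx hx₀
  have hc := (memLp_congr_ae hu').1 hLq
  rw [memLp_const_iff hq hq'] at hc
  have : Nonempty (Fin d) := ⟨⟨0, Nat.pos_of_ne_zero hd⟩⟩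
  have : Nontrivial (EuclideanSpace ℝ (Fin d)) :=
    ⟨⟨0, EuclideanSpace.single ⟨0, Nat.pos_of_ne_zero hd⟩ 1, fun h => by simpa using h.symm⟩⟩
  rcases hc with hc | hc
  · filter_upwards [hu'] with x hx
    simpa [hc] using hx
  · rw [measure_univ_of_isAddLeftInvariant] at hc
    exact absurd hc (lt_irrefl _)

theorem lintegral_sq_sub_translate_smooth {d : ℕ} {w : EuclideanSpace ℝ (Fin d) → ℂ}
    {G : EuclideanSpace ℝ (Fin d) → EuclideanSpace ℂ (Fin d)} (hw : ContDiff ℝ 1 w)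
    (hG : ∀ x, ‖fderiv ℝ w x‖ ≤ ‖G x‖) (y : EuclideanSpace ℝ (Fin d)) :
    ∫⁻ x, ‖w x - w (x - y)‖ₑ ^ 2 ≤ ‖y‖ₑ ^ 2 * ∫⁻ x, ‖G x‖ₑ ^ 2 := by
  have hcf : Continuous (fderiv ℝ w) := hw.continuous_fderiv (by simp)
  have e : ∀ x, w x - w (x - y)
      = ∫ t, (1 : ℝ) • fderiv ℝ w (x - t • y) y ∂(volume.restrict (Set.Ioc (0 : ℝ) 1)) := fun x => by
    have hderiv : ∀ t ∈ Set.uIcc (0 : ℝ) 1,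
        HasDerivAt (fun t : ℝ => - w (x - t • y)) (fderiv ℝ w (x - t • y) y) t := fun t _ => by
      have h1 : HasDerivAt (fun t : ℝ => x - t • y) (-y) t := by
        simpa using ((hasDerivAt_id t).smul_const y).const_sub x
      have h2 := ((hw.differentiable (by simp) (x - t • y)).hasFDerivAt).comp_hasDerivAt t h1
      simpa [Function.comp_def] using h2.fun_neg
    have hcont : Continuous fun t : ℝ => fderiv ℝ w (x - t • y) y := by fun_prop
    have h := intervalIntegral.integral_eq_sub_of_hasDerivAt hderiv
      (hcont.intervalIntegrable 0 1)
    rw [intervalIntegral.integral_of_le zero_le_one] at h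
    simp only [one_smul]
    rw [h]
    simp
    ring
  simp_rw [e]
  refine lintegral_sq_average_le (h := fun x (t : ℝ) => fderiv ℝ w (x - t • y) y)
    (ρ := fun _ => (1 : ℝ)) measurable_const (fun _ => zero_le_one) (by simp) ?_
    (Eventually.of_forall fun t _ => ?_)
  · refine Continuous.aestronglyMeasurable ?_
    have : Continuous fun z : EuclideanSpace ℝ (Fin d) × ℝ => fderiv ℝ w (z.1 - z.2 • y) y := by
      fun_prop
    exact this
  · calc ∫⁻ x, ‖fderiv ℝ w (x - t • y) y‖ₑ ^ 2
        ≤ ∫⁻ x, ‖y‖ₑ ^ 2 * ‖G (x - t • y)‖ₑ ^ 2 := by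
          refine lintegral_mono fun x => ?_
          rw [← mul_pow]
          gcongr
          rw [mul_comm]
          refine ((fderiv ℝ w (x - t • y)).le_opENorm y).trans ?_
          gcongr
          exact enorm_le_iff_norm_le.2 (hG _)
      _ = ‖y‖ₑ ^ 2 * ∫⁻ x, ‖G (x - t • y)‖ₑ ^ 2 := lintegral_const_mul' _ _ (by simp)
      _ = _ := by rw [lintegral_sub_right_eq_self (fun x => ‖G x‖ₑ ^ 2) (t • y)]

/-- The translation estimate `‖u - u(· - y)‖₂ ≤ |y| ‖∇u‖₂`. -/
theorem HasWeakGradient.lintegral_sq_sub_translate {d : ℕ} {u : EuclideanSpace ℝ (Fin d) → ℂ}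
    {g : EuclideanSpace ℝ (Fin d) → EuclideanSpace ℂ (Fin d)} (hu : HasWeakGradient u g)
    (y : EuclideanSpace ℝ (Fin d)) :
    ∫⁻ x, ‖u x - u (x - y)‖ₑ ^ 2 ≤ ‖y‖ₑ ^ 2 * ∫⁻ x, ‖g x‖ₑ ^ 2 := by
  have h1 : ∀ n, ∫⁻ x, ‖smear (mollifier d n) u x - smear (mollifier d n) u (x - y)‖ₑ ^ 2
      ≤ ‖y‖ₑ ^ 2 * ∫⁻ x, ‖g x‖ₑ ^ 2 := fun n => by
    refine (lintegral_sq_sub_translate_smooth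
      ((contDiff_smear (contDiff_mollifier d n) (hasCompactSupport_mollifier d n) hu.1).of_le
        (by exact_mod_cast le_top))
      (hu.norm_fderiv_smear_le (contDiff_mollifier d n) (hasCompactSupport_mollifier d n))
      y).trans ?_
    rw [← eLpNorm_two_sq, ← eLpNorm_two_sq]
    gcongr
    exact eLpNorm_smear_mollifier_le n hu.2.1.aestronglyMeasurable
  have hlim := ae_tendsto_smear_mollifier hu.1
  have hlim' := (measurePreserving_sub_right volume y).quasiMeasurePreserving.ae hlim
  calc ∫⁻ x, ‖u x - u (x - y)‖ₑ ^ 2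
      ≤ ∫⁻ x, liminf (fun n =>
          ‖smear (mollifier d n) u x - smear (mollifier d n) u (x - y)‖ₑ ^ 2) atTop := by
        refine lintegral_mono_ae ?_
        filter_upwards [hlim, hlim'] with x hx hx'
        have := ((ENNReal.continuous_pow 2).tendsto _).comp (hx.sub hx').enorm
        exact this.liminf_eq.ge
    _ ≤ liminf (fun n => ∫⁻ x,
          ‖smear (mollifier d n) u x - smear (mollifier d n) u (x - y)‖ₑ ^ 2) atTop := by
        refine lintegral_liminf_le' fun n => ?_
        have hm := aestronglyMeasurable_smear n hu.1
        exact ((hm.sub (hm.comp_measurePreserving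
          (measurePreserving_sub_right volume y))).enorm.pow_const 2)
    _ ≤ ‖y‖ₑ ^ 2 * ∫⁻ x, ‖g x‖ₑ ^ 2 :=
        liminf_le_of_le (by isBoundedDefault) fun b hb => by
          obtain ⟨n, hn⟩ := hb.exists
          exact hn.trans (h1 n)

/-- `u` is `L^2`-close to its mollifications, at a rate depending only on `‖∇u‖₂`: average the
translation estimate over the mollifier. -/
theorem HasWeakGradient.eLpNorm_sub_smear_le {d : ℕ} {u : EuclideanSpace ℝ (Fin d) → ℂ}
    {g : EuclideanSpace ℝ (Fin d) → EuclideanSpace ℂ (Fin d)} (hu : HasWeakGradient u g) (n : ℕ) :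
    eLpNorm (fun x => u x - smear (mollifier d n) u x) 2
      ≤ ENNReal.ofReal (1 / ((n : ℝ) + 1)) * eLpNorm g 2 := by
  have e : ∀ x, u x - smear (mollifier d n) u x
      = ∫ t, mollifier d n t • (u x - u (x - t)) := fun x => by
    have hi := (contDiff_mollifier d n).continuous.integrable_of_hasCompactSupport (μ := volume)
      (hasCompactSupport_mollifier d n)
    simp_rw [smul_sub]
    rw [integral_sub (hi.smul_const _) (integrable_smear (contDiff_mollifier d n).continuous
      (hasCompactSupport_mollifier d n) hu.1 x), integral_smul_const, integral_mollifier, one_smul]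
    rfl
  refine le_of_sq_le_sq ?_
  rw [eLpNorm_two_sq, mul_pow, eLpNorm_two_sq]
  simp_rw [e]
  refine lintegral_sq_average_le (h := fun x t => u x - u (x - t))
    (contDiff_mollifier d n).continuous.measurable (mollifier_nonneg d n)
    (lintegral_mollifier d n).le
    (hu.1.aestronglyMeasurable.comp_fst.sub
      (aestronglyMeasurable_sub_uncurry hu.1.aestronglyMeasurable))
    (Eventually.of_forall fun t ht => (hu.lintegral_sq_sub_translate t).trans ?_)
  gcongr
  rw [← ofReal_norm]
  exact ENNReal.ofReal_le_ofReal (norm_lt_of_mollifier_ne_zero ht).le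

theorem two_lt_critExp {d : ℕ} (hd : 3 ≤ d) : 2 < critExp d := by
  have hd' : (3 : ℝ) ≤ d := by exact_mod_cast hd
  unfold critExp
  rw [lt_div_iff₀ (by linarith)]
  linarith

theorem unitBump_mem (d : ℕ) (x : EuclideanSpace ℝ (Fin d)) : 0 ≤ unitBump d x ∧ unitBump d x ≤ 1 :=
  ⟨(unitBump d).nonneg, (unitBump d).le_one⟩

theorem exists_bound_fderiv_unitBump (d : ℕ) :
    ∃ K : ℝ, 0 ≤ K ∧ ∀ x, ‖fderiv ℝ (unitBump d) x‖ ≤ K := by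
  obtain ⟨K, hK⟩ := ((unitBump d).hasCompactSupport.fderiv (𝕜 := ℝ)).exists_bound_of_continuous
    ((unitBump d).contDiff.continuous_fderiv (n := 1) (by simp))
  exact ⟨K, (norm_nonneg _).trans (hK 0), hK⟩

/-- The Gagliardo–Nirenberg–Sobolev inequality for test functions, with the exponent
`2d / (d - 2)`. -/
theorem exists_sobolev_smooth {d : ℕ} (hd : 3 ≤ d) :
    ∃ C : ℝ≥0, ∀ w : EuclideanSpace ℝ (Fin d) → ℂ, ContDiff ℝ 1 w → HasCompactSupport w →
      eLpNorm w (ENNReal.ofReal (critExp d)) ≤ C * eLpNorm (fderiv ℝ w) 2 := by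
  refine ⟨SNormLESNormFDerivOfEqConst ℂ (volume : Measure (EuclideanSpace ℝ (Fin d))) 2,
    fun w hw hc => ?_⟩
  have hd' : (3 : ℝ) ≤ d := by exact_mod_cast hd
  have hq := two_lt_critExp hd
  have := eLpNorm_le_eLpNorm_fderiv_of_eq (μ := (volume : Measure (EuclideanSpace ℝ (Fin d)))) hw hc
    (p := 2) (p' := (critExp d).toNNReal) (by norm_num) (by simp; omega) (by
      rw [Real.coe_toNNReal _ (by linarith)]
      simp [critExp]
      field_simp)
  simpa [ENNReal.ofReal] using this

/-- A smooth cutoff, equal to `1` on the ball of radius `n + 1`. -/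
def cutoff (d n : ℕ) (x : EuclideanSpace ℝ (Fin d)) : ℝ := unitBump d (((n : ℝ) + 1)⁻¹ • x)

theorem contDiff_cutoff (d n : ℕ) : ContDiff ℝ 1 (cutoff d n) :=
  (unitBump d).contDiff.comp (contDiff_const_smul _)

theorem hasCompactSupport_cutoff (d n : ℕ) : HasCompactSupport (cutoff d n) :=
  (unitBump d).hasCompactSupport.comp_homeomorph
    (Homeomorph.smulOfNeZero (((n : ℝ) + 1)⁻¹) (by positivity))

theorem norm_cutoff_le (d n : ℕ) (x : EuclideanSpace ℝ (Fin d)) : ‖cutoff d n x‖ ≤ 1 := by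
  have h := unitBump_mem d (((n : ℝ) + 1)⁻¹ • x)
  rw [cutoff, Real.norm_of_nonneg h.1]
  exact h.2

theorem norm_fderiv_cutoff_le {d : ℕ} {K : ℝ} (hK : ∀ x, ‖fderiv ℝ (unitBump d) x‖ ≤ K) (n : ℕ)
    (x : EuclideanSpace ℝ (Fin d)) : ‖fderiv ℝ (cutoff d n) x‖ ≤ K := by
  have h : fderiv ℝ (cutoff d n) x
      = ((n : ℝ) + 1)⁻¹ • fderiv ℝ (unitBump d) (((n : ℝ) + 1)⁻¹ • x) := fderiv_comp_smul _
  have hK0 : 0 ≤ K := (norm_nonneg _).trans (hK x)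
  rw [h, norm_smul, Real.norm_of_nonneg (by positivity)]
  calc ((n : ℝ) + 1)⁻¹ * ‖fderiv ℝ (unitBump d) (((n : ℝ) + 1)⁻¹ • x)‖ ≤ 1 * K := by
        gcongr
        · exact inv_le_one_of_one_le₀ (by linarith [n.cast_nonneg (α := ℝ)])
        · exact hK _
    _ = K := one_mul K

theorem cutoff_eventually_eq_one {d : ℕ} (x : EuclideanSpace ℝ (Fin d)) :
    ∀ᶠ n in atTop, cutoff d n x = 1 := by
  filter_upwards [eventually_ge_atTop ⌈‖x‖⌉₊] with n hn
  have hn' : ‖x‖ ≤ n := Nat.ceil_le.1 hn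
  refine (unitBump d).one_of_mem_closedBall ?_
  rw [mem_closedBall_zero_iff, norm_smul, Real.norm_of_nonneg (by positivity)]
  change _ ≤ (1 : ℝ)
  rw [inv_mul_le_iff₀ (by positivity)]
  linarith

theorem norm_fderiv_cutoff_smul_le {d : ℕ} {K : ℝ} (hK : ∀ x, ‖fderiv ℝ (unitBump d) x‖ ≤ K)
    (n : ℕ) {w : EuclideanSpace ℝ (Fin d) → ℂ} (hw : ContDiff ℝ 1 w)
    (x : EuclideanSpace ℝ (Fin d)) :
    ‖fderiv ℝ (fun x => cutoff d n x • w x) x‖ ≤ ‖fderiv ℝ w x‖ + K * ‖w x‖ := by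
  rw [fderiv_fun_smul ((contDiff_cutoff d n).differentiable (by simp) x)
    (hw.differentiable (by simp) x)]
  refine (norm_add_le _ _).trans (add_le_add ?_ ?_)
  · rw [norm_smul]
    exact mul_le_of_le_one_left (norm_nonneg _) (norm_cutoff_le d n x)
  · rw [ContinuousLinearMap.norm_smulRight_apply]
    gcongr
    exact norm_fderiv_cutoff_le hK n x

/-- The Sobolev inequality on `H^1(ℝ^d)`, with the full `H^1` norm on the right-hand side. The
inequality for test functions is applied to cutoffs of mollifications, and Fatou's lemma gives the
limit. -/
theorem exists_sobolev {d : ℕ} (hd : 3 ≤ d) :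
    ∃ C : ℝ≥0, ∀ (u : EuclideanSpace ℝ (Fin d) → ℂ)
      (g : EuclideanSpace ℝ (Fin d) → EuclideanSpace ℂ (Fin d)), HasWeakGradient u g →
      eLpNorm u (ENNReal.ofReal (critExp d)) ≤ C * (eLpNorm g 2 + eLpNorm u 2) := by
  obtain ⟨C, hC⟩ := exists_sobolev_smooth hd
  obtain ⟨K, hK0, hK⟩ := exists_bound_fderiv_unitBump d
  refine ⟨C * (1 + K.toNNReal), fun u g hu => ?_⟩
  have hUs : ∀ n, ContDiff ℝ 1 (smear (mollifier d n) u) := fun n =>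
    (contDiff_smear (contDiff_mollifier d n) (hasCompactSupport_mollifier d n) hu.1).of_le
        (by exact_mod_cast le_top)
  have hws : ∀ n, ContDiff ℝ 1 (fun x => cutoff d n x • smear (mollifier d n) u x) := fun n =>
    (contDiff_cutoff d n).smul (hUs n)
  have hb : ∀ n, eLpNorm (fun x => cutoff d n x • smear (mollifier d n) u x)
      (ENNReal.ofReal (critExp d)) ≤ C * (eLpNorm g 2 + K.toNNReal * eLpNorm u 2) := fun n => by
    refine (hC _ (hws n) (hasCompactSupport_cutoff d n).smul_right).trans ?_
    gcongr
    have m1 := aestronglyMeasurable_smear n hu.1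
    have m2 := aestronglyMeasurable_smear n hu.2.1
    have hwd : ∀ x, ‖fderiv ℝ (fun x => cutoff d n x • smear (mollifier d n) u x) x‖
        ≤ ‖smear (mollifier d n) g x‖ + K * ‖smear (mollifier d n) u x‖ := fun x =>
      (norm_fderiv_cutoff_smul_le hK n (hUs n) x).trans (by
        gcongr
        exact hu.norm_fderiv_smear_le (contDiff_mollifier d n) (hasCompactSupport_mollifier d n) x)
    refine (eLpNorm_mono_real hwd).trans ((eLpNorm_add_le m2.norm (m1.norm.const_mul K)
      (by norm_num)).trans (add_le_add ?_ ?_))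
    · rw [eLpNorm_norm]
      exact eLpNorm_smear_mollifier_le n hu.2.1.aestronglyMeasurable
    · have h := eLpNorm_const_smul K (fun x => ‖smear (mollifier d n) u x‖) 2
        (volume : Measure (EuclideanSpace ℝ (Fin d)))
      have h' : eLpNorm (fun x => K * ‖smear (mollifier d n) u x‖) 2 volume
          = ‖K‖ₑ * eLpNorm (fun x => ‖smear (mollifier d n) u x‖) 2 volume := h
      rw [h', eLpNorm_norm, Real.enorm_of_nonneg hK0]
      exact mul_le_mul' le_rfl (eLpNorm_smear_mollifier_le n hu.1.aestronglyMeasurable)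
  have hlim : ∀ᵐ x, Tendsto (fun n => cutoff d n x • smear (mollifier d n) u x) atTop
      (𝓝 (u x)) := by
    filter_upwards [ae_tendsto_smear_mollifier hu.1] with x hx
    refine hx.congr' ?_
    filter_upwards [cutoff_eventually_eq_one x] with n hn
    rw [hn, one_smul]
  refine (Lp.eLpNorm_lim_le_liminf_eLpNorm (fun n => (hws n).continuous.aestronglyMeasurable)
    u hlim).trans ?_
  refine (liminf_le_of_le (by isBoundedDefault) fun b hb' => ?_ :
    _ ≤ (C : ℝ≥0∞) * (eLpNorm g 2 + K.toNNReal * eLpNorm u 2)).trans ?_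
  · obtain ⟨n, hn⟩ := hb'.exists
    exact hn.trans (hb n)
  · push_cast
    rw [mul_assoc]
    gcongr
    calc eLpNorm g 2 volume + K.toNNReal * eLpNorm u 2 volume
        ≤ (eLpNorm g 2 volume + K.toNNReal * eLpNorm u 2 volume)
          + (eLpNorm u 2 volume + K.toNNReal * eLpNorm g 2 volume) := le_self_add
      _ = _ := by ring

/-! ### The Brezis–Lieb lemma and comparison of powers -/

/-- The pointwise inequality behind the Brezis–Lieb lemma. -/
theorem exists_abs_rpow_sub_le {r : ℝ} (hr : 0 < r) {ε : ℝ} (hε : 0 < ε) :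
    ∃ C : ℝ, 0 ≤ C ∧ ∀ s t A : ℝ, 0 ≤ s → 0 ≤ t → |s - t| ≤ A →
      |s ^ r - t ^ r| ≤ ε * t ^ r + C * A ^ r := by
  have hcont : ContinuousAt (fun x : ℝ => x ^ r) 1 :=
    Real.continuousAt_rpow_const _ _ (Or.inl one_ne_zero)
  obtain ⟨δ, hδ, hδ'⟩ := Metric.continuousAt_iff.1 hcont ε hε
  refine ⟨(1 / δ + 1) ^ r, by positivity, fun s t A hs ht hA => ?_⟩
  have hA0 : 0 ≤ A := (abs_nonneg _).trans hA
  rcases lt_or_ge A (δ * t) with h | h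
  · have ht0 : 0 < t := by
      rcases ht.lt_or_eq with h' | h'
      · exact h'
      · rw [← h'] at h
        linarith
    have h1 : dist (s / t) 1 < δ := by
      rw [Real.dist_eq, div_sub_one ht0.ne', abs_div, abs_of_pos ht0, div_lt_iff₀ ht0]
      linarith
    have h2 := hδ' h1
    rw [Real.dist_eq, Real.one_rpow, Real.div_rpow hs ht,
      div_sub_one (Real.rpow_pos_of_pos ht0 r).ne', abs_div,
      abs_of_pos (Real.rpow_pos_of_pos ht0 r), div_lt_iff₀ (Real.rpow_pos_of_pos ht0 r)] at h2
    have : 0 ≤ (1 / δ + 1) ^ r * A ^ r := by positivity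
    linarith
  · have ht' : t ≤ (1 / δ + 1) * A := by
      have : t ≤ 1 / δ * A := by
        rw [one_div, ← div_eq_inv_mul, le_div_iff₀ hδ]
        linarith
      linarith
    have hs' : s ≤ (1 / δ + 1) * A := by
      have : t ≤ 1 / δ * A := by
        rw [one_div, ← div_eq_inv_mul, le_div_iff₀ hδ]
        linarith
      have := (abs_le.1 hA).2
      linarith
    have e1 : s ^ r ≤ (1 / δ + 1) ^ r * A ^ r := by
      rw [← Real.mul_rpow (by positivity) hA0]
      exact Real.rpow_le_rpow hs hs' hr.le
    have e2 : t ^ r ≤ (1 / δ + 1) ^ r * A ^ r := by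
      rw [← Real.mul_rpow (by positivity) hA0]
      exact Real.rpow_le_rpow ht ht' hr.le
    have p1 : 0 ≤ s ^ r := by positivity
    have p2 : 0 ≤ t ^ r := by positivity
    have p3 : 0 ≤ ε * t ^ r := by positivity
    rw [abs_le]
    constructor <;> linarith

/-- The Brezis–Lieb lemma. -/
theorem tendsto_integral_rpow_sub_of_ae {X F : Type*} [MeasurableSpace X] {μ : Measure X}
    [NormedAddCommGroup F] {r : ℝ} (hr : 0 < r) {f : ℕ → X → F} {f' : X → F}
    (hf : ∀ n, Integrable (fun x => ‖f n x‖ ^ r) μ) (hf' : Integrable (fun x => ‖f' x‖ ^ r) μ)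
    (hd : ∀ n, Integrable (fun x => ‖f n x - f' x‖ ^ r) μ) {M : ℝ}
    (hM : ∀ n, ∫ x, ‖f n x - f' x‖ ^ r ∂μ ≤ M)
    (hlim : ∀ᵐ x ∂μ, Tendsto (fun n => f n x) atTop (𝓝 (f' x))) :
    Tendsto (fun n => ∫ x, ‖f n x‖ ^ r ∂μ - ∫ x, ‖f n x - f' x‖ ^ r ∂μ) atTop
      (𝓝 (∫ x, ‖f' x‖ ^ r ∂μ)) := by
  have hM0 : 0 ≤ M := (integral_nonneg fun x => by positivity).trans (hM 0)
  set D : ℕ → X → ℝ := fun n x => ‖f n x‖ ^ r - ‖f n x - f' x‖ ^ r - ‖f' x‖ ^ r with hD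
  have hDi : ∀ n, Integrable (D n) μ := fun n => ((hf n).sub (hd n)).sub hf'
  have hDe : ∀ n, ∫ x, D n x ∂μ
      = ∫ x, ‖f n x‖ ^ r ∂μ - ∫ x, ‖f n x - f' x‖ ^ r ∂μ - ∫ x, ‖f' x‖ ^ r ∂μ := fun n => by
    have h1 : Integrable (fun x => ‖f n x‖ ^ r - ‖f n x - f' x‖ ^ r) μ := (hf n).sub (hd n)
    simp only [hD]
    rw [integral_sub h1 hf', integral_sub (hf n) (hd n)]
  suffices h : Tendsto (fun n => ∫ x, D n x ∂μ) atTop (𝓝 0) by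
    simpa [hDe] using h.add_const (∫ x, ‖f' x‖ ^ r ∂μ)
  rw [Metric.tendsto_atTop]
  intro η hη
  obtain ⟨C, hC0, hC⟩ := exists_abs_rpow_sub_le hr (ε := η / (2 * (M + 1))) (by positivity)
  set ε := η / (2 * (M + 1)) with hε
  -- the part of `|D n|` that is not controlled by `ε |f n - f'| ^ r` is dominated
  have hW : Tendsto (fun n => ∫ x, max (|D n x| - ε * ‖f n x - f' x‖ ^ r) 0 ∂μ) atTop
      (𝓝 (∫ _x, (0 : ℝ) ∂μ)) := by
    refine tendsto_integral_of_dominated_convergence (fun x => (C + 1) * ‖f' x‖ ^ r)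
      (fun n => ?_) (hf'.const_mul _) (fun n => Eventually.of_forall fun x => ?_) ?_
    · exact (((hDi n).abs.sub ((hd n).const_mul ε)).pos_part).aestronglyMeasurable
    · have h1 := hC ‖f n x‖ ‖f n x - f' x‖ ‖f' x‖ (norm_nonneg _) (norm_nonneg _) (by
        refine (abs_norm_sub_norm_le _ _).trans (le_of_eq ?_)
        congr 1
        abel)
      have h2 : 0 ≤ ‖f' x‖ ^ r := by positivity
      have h3 : |D n x| ≤ |‖f n x‖ ^ r - ‖f n x - f' x‖ ^ r| + |‖f' x‖ ^ r| := abs_sub _ _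
      rw [abs_of_nonneg h2] at h3
      rw [Real.norm_of_nonneg (le_max_right _ _)]
      refine max_le ?_ (by positivity)
      linarith
    · filter_upwards [hlim] with x hx
      have l1 : Tendsto (fun n => ‖f n x‖ ^ r) atTop (𝓝 (‖f' x‖ ^ r)) :=
        hx.norm.rpow_const (Or.inr hr.le)
      have l2 : Tendsto (fun n => ‖f n x - f' x‖ ^ r) atTop (𝓝 0) := by
        have := (hx.sub_const (f' x)).norm.rpow_const (p := r) (Or.inr hr.le)
        simpa [Real.zero_rpow hr.ne'] using this
      have l3 : Tendsto (fun n => max (|D n x| - ε * ‖f n x - f' x‖ ^ r) 0) atTop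
          (𝓝 (max (|‖f' x‖ ^ r - 0 - ‖f' x‖ ^ r| - ε * 0) 0)) :=
        ((((l1.sub l2).sub_const _).abs.sub (l2.const_mul ε)).max tendsto_const_nhds)
      simpa using l3
  rw [integral_zero] at hW
  obtain ⟨N, hN⟩ := Metric.tendsto_atTop.1 hW (η / 2) (by positivity)
  refine ⟨N, fun n hn => ?_⟩
  have h1 := hN n hn
  rw [Real.dist_eq, sub_zero] at h1 ⊢
  have h2 : |∫ x, D n x ∂μ| ≤ ∫ x, max (|D n x| - ε * ‖f n x - f' x‖ ^ r) 0 ∂μ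
      + ε * ∫ x, ‖f n x - f' x‖ ^ r ∂μ := by
    have hi : Integrable (fun x => max (|D n x| - ε * ‖f n x - f' x‖ ^ r) 0) μ :=
      ((hDi n).abs.sub ((hd n).const_mul ε)).pos_part
    rw [← integral_const_mul, ← integral_add hi ((hd n).const_mul ε)]
    refine (abs_integral_le_integral_abs).trans (integral_mono (hDi n).abs
      (hi.add ((hd n).const_mul ε)) fun x => ?_)
    have := le_max_left (|D n x| - ε * ‖f n x - f' x‖ ^ r) 0
    simp only
    linarith
  have h3 : ε * ∫ x, ‖f n x - f' x‖ ^ r ∂μ ≤ η / 2 := by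
    calc ε * ∫ x, ‖f n x - f' x‖ ^ r ∂μ ≤ ε * (M + 1) := by
          gcongr
          linarith [hM n]
      _ = η / 2 := by rw [hε]; field_simp
  have h4 := (abs_lt.1 h1).2
  linarith

/-- An intermediate power is small relative to `t ^ 2 + t ^ s` except on a compact range of `t`,
where every power `t ^ q` bounds it up to a constant. -/
theorem exists_rpow_le_of_between {r s : ℝ} (hr : 2 < r) (hrs : r < s) (q : ℝ) {ε : ℝ}
    (hε : 0 < ε) :
    ∃ C : ℝ, 0 ≤ C ∧ ∀ t : ℝ, 0 < t → t ^ r ≤ ε * (t ^ 2 + t ^ s) + C * t ^ q := by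
  -- Beyond the threshold `T` the power `t ^ s` dominates; below it, `t ^ s` is at most a multiple
  -- of `t ^ q` as long as `t` is bounded away from zero.
  set τ := ε ^ (1 / (r - 2)) with hτ
  set T := ε ^ (1 / (r - s)) with hT
  have hτ0 : 0 < τ := by positivity
  have hT0 : 0 < T := by positivity
  obtain ⟨K, hK⟩ := (isCompact_Icc (a := τ) (b := T)).exists_bound_of_continuousOn
    (f := fun t : ℝ => t ^ (r - q)) (fun t ht =>
      (Real.continuousAt_rpow_const _ _ (Or.inl (hτ0.trans_le ht.1).ne')).continuousWithinAt)
  refine ⟨max K 0, le_max_right _ _, fun t ht => ?_⟩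
  have p2 : 0 < t ^ 2 := by positivity
  have ps : 0 < t ^ s := by positivity
  have pq : 0 < t ^ q := by positivity
  have hK0 : 0 ≤ max K 0 * t ^ q := by positivity
  rcases le_total t τ with h | h
  · have h1 : t ^ (r - 2) ≤ ε := by
      calc t ^ (r - 2) ≤ τ ^ (r - 2) := Real.rpow_le_rpow ht.le h (by linarith)
        _ = ε := by
          rw [hτ, ← Real.rpow_mul hε.le, one_div_mul_cancel (by linarith), Real.rpow_one]
    have h2 : t ^ r = t ^ (r - 2) * t ^ 2 := by
      rw [← Real.rpow_natCast t 2, ← Real.rpow_add ht]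
      norm_num
    rw [h2]
    nlinarith [mul_le_mul_of_nonneg_right h1 p2.le, mul_pos hε ps]
  rcases le_total t T with h' | h'
  · have h1 := (le_abs_self _).trans (hK t ⟨h, h'⟩)
    have h2 : t ^ r = t ^ (r - q) * t ^ q := by
      rw [← Real.rpow_add ht]
      norm_num
    rw [h2]
    have := mul_le_mul_of_nonneg_right (h1.trans (le_max_left K 0)) pq.le
    have : 0 ≤ ε * (t ^ 2 + t ^ s) := by positivity
    linarith
  · have h1 : t ^ (r - s) ≤ ε := by
      calc t ^ (r - s) ≤ T ^ (r - s) := Real.rpow_le_rpow_of_nonpos hT0 h' (by linarith)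
        _ = ε := by
          rw [hT, ← Real.rpow_mul hε.le, one_div_mul_cancel (by linarith), Real.rpow_one]
    have h2 : t ^ r = t ^ (r - s) * t ^ s := by
      rw [← Real.rpow_add ht]
      norm_num
    rw [h2]
    nlinarith [mul_le_mul_of_nonneg_right h1 ps.le, mul_pos hε p2]

theorem exists_rpow_le_sq_add {r s : ℝ} (hr : 2 < r) (hrs : r < s) {ε : ℝ} (hε : 0 < ε) :
    ∃ C : ℝ, 0 ≤ C ∧ ∀ t : ℝ, 0 ≤ t → t ^ r ≤ ε * t ^ 2 + C * t ^ s := by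
  obtain ⟨C, hC0, hC⟩ := exists_rpow_le_of_between hr hrs s hε
  refine ⟨ε + C, by positivity, fun t ht => ?_⟩
  rcases ht.eq_or_lt with rfl | ht
  · rw [Real.zero_rpow (by linarith), Real.zero_rpow (by linarith)]
    simp
  · linarith [hC t ht]

/-! ### Weak convergence in `L^2` -/

/-- Weak convergence of square-integrable vector-valued functions, tested against all of `L^2`. -/
def WeakTendsto {X F : Type*} [MeasurableSpace X] [NormedAddCommGroup F] [InnerProductSpace ℂ F]
    (μ : Measure X) (f : ℕ → X → F) (f' : X → F) : Prop :=
  ∀ h : X → F, MemLp h 2 μ →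
    Tendsto (fun n => ∫ x, inner ℂ (h x) (f n x) ∂μ) atTop (𝓝 (∫ x, inner ℂ (h x) (f' x) ∂μ))

theorem integrable_norm_sq_of_memLp {X F : Type*} [MeasurableSpace X] [NormedAddCommGroup F]
    {μ : Measure X} {f : X → F} (hf : MemLp f 2 μ) : Integrable (fun x => ‖f x‖ ^ 2) μ :=
  hf.integrable_norm_pow two_ne_zero

section Weak

variable {X F : Type*} [MeasurableSpace X] [NormedAddCommGroup F] [InnerProductSpace ℂ F]
  {μ : Measure X}

theorem integrable_inner_of_memLp {f g : X → F} (hf : MemLp f 2 μ) (hg : MemLp g 2 μ) :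
    Integrable (fun x => inner ℂ (f x) (g x)) μ := by
  refine (L2.integrable_inner (𝕜 := ℂ) (hf.toLp f) (hg.toLp g)).congr ?_
  filter_upwards [hf.coeFn_toLp, hg.coeFn_toLp] with x h1 h2
  rw [h1, h2]

theorem WeakTendsto.comp {f : ℕ → X → F} {f' : X → F} (h : WeakTendsto μ f f') {ns : ℕ → ℕ}
    (hns : StrictMono ns) : WeakTendsto μ (fun n => f (ns n)) f' :=
  fun k hk => (h k hk).comp hns.tendsto_atTop

theorem WeakTendsto.sub_const {f : ℕ → X → F} {f' : X → F} (h : WeakTendsto μ f f')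
    (hf : ∀ n, MemLp (f n) 2 μ) (hf' : MemLp f' 2 μ) :
    WeakTendsto μ (fun n x => f n x - f' x) (fun _ => 0) := by
  intro k hk
  have := (h k hk).sub_const (∫ x, inner ℂ (k x) (f' x) ∂μ)
  rw [sub_self] at this
  simp only [inner_zero_right, integral_zero]
  refine this.congr fun n => ?_
  simp_rw [inner_sub_right]
  rw [integral_sub (integrable_inner_of_memLp hk (hf n)) (integrable_inner_of_memLp hk hf')]

/-- Bounded sequences in `L^2` have weakly convergent subsequences. -/
theorem exists_weakTendsto [CompleteSpace F] [SecondCountableTopology (Lp F 2 μ)]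
    {f : ℕ → X → F} (hf : ∀ n, MemLp (f n) 2 μ) {M : ℝ}
    (hM : ∀ n, eLpNorm (f n) 2 μ ≤ ENNReal.ofReal M) :
    ∃ (f' : X → F) (ns : ℕ → ℕ), MemLp f' 2 μ ∧ StrictMono ns ∧
      WeakTendsto μ (fun n => f (ns n)) f' := by
  set D := InnerProductSpace.toDual ℂ (Lp F 2 μ)
  have hmem : ∀ n, StrongDual.toWeakDual (D ((hf n).toLp (f n))) ∈
      WeakDual.toStrongDual ⁻¹' Metric.closedBall (0 : StrongDual ℂ (Lp F 2 μ)) (max M 0) :=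
    fun n => by
      change D ((hf n).toLp (f n)) ∈ Metric.closedBall (0 : StrongDual ℂ (Lp F 2 μ)) (max M 0)
      rw [mem_closedBall_zero_iff, LinearIsometryEquiv.norm_map, Lp.norm_toLp]
      refine ENNReal.toReal_le_of_le_ofReal (le_max_right _ _) ((hM n).trans ?_)
      exact ENNReal.ofReal_le_ofReal (le_max_left _ _)
  obtain ⟨ψ, -, ns, hns, hψ⟩ :=
    WeakDual.isSeqCompact_closedBall ℂ (Lp F 2 μ) 0 (max M 0) hmem
  refine ⟨D.symm (WeakDual.toStrongDual ψ), ns, Lp.memLp _, hns, fun h hh => ?_⟩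
  have h1 := ((WeakDual.eval_continuous (hh.toLp h)).tendsto ψ).comp hψ
  have h2 : Tendsto (fun n => inner ℂ ((hf (ns n)).toLp (f (ns n))) (hh.toLp h)) atTop
      (𝓝 (inner ℂ (D.symm (WeakDual.toStrongDual ψ)) (hh.toLp h))) := by
    have e : inner ℂ (D.symm (WeakDual.toStrongDual ψ)) (hh.toLp h) = ψ (hh.toLp h) :=
      InnerProductSpace.toDual_symm_apply
    rw [e]
    exact h1
  have h3 := (Complex.continuous_conj.tendsto _).comp h2
  have key : ∀ k : Lp F 2 μ, ∫ x, inner ℂ (h x) (k x) ∂μ = (starRingEnd ℂ) (inner ℂ k (hh.toLp h)) :=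
    fun k => by
      rw [inner_conj_symm, L2.inner_def]
      refine integral_congr_ae ?_
      filter_upwards [hh.coeFn_toLp] with x hx
      rw [hx]
  rw [key]
  refine h3.congr fun n => ?_
  change (starRingEnd ℂ) (inner ℂ ((hf (ns n)).toLp (f (ns n))) (hh.toLp h)) = _
  rw [← key]
  refine integral_congr_ae ?_
  filter_upwards [(hf (ns n)).coeFn_toLp] with x hx
  rw [hx]

/-- The Pythagorean splitting of the `L^2` norm along a weakly convergent sequence. -/
theorem WeakTendsto.tendsto_integral_sq_sub {f : ℕ → X → F} {f' : X → F}
    (h : WeakTendsto μ f f') (hf : ∀ n, MemLp (f n) 2 μ) (hf' : MemLp f' 2 μ) :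
    Tendsto (fun n => ∫ x, ‖f n x‖ ^ 2 ∂μ - ∫ x, ‖f n x - f' x‖ ^ 2 ∂μ) atTop
      (𝓝 (∫ x, ‖f' x‖ ^ 2 ∂μ)) := by
  have h1 : ∀ g : X → F, MemLp g 2 μ → ∫ x, (inner ℂ (f' x) (g x)).re ∂μ
      = (∫ x, inner ℂ (f' x) (g x) ∂μ).re := fun g hg =>
    integral_re (integrable_inner_of_memLp hf' hg)
  have h2 := ((Complex.continuous_re.tendsto _).comp (h f' hf')).const_mul 2
  have h3 := h2.sub_const (∫ x, ‖f' x‖ ^ 2 ∂μ)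
  have e : 2 * (∫ x, inner ℂ (f' x) (f' x) ∂μ).re - ∫ x, ‖f' x‖ ^ 2 ∂μ = ∫ x, ‖f' x‖ ^ 2 ∂μ := by
    rw [← h1 f' hf']
    have : ∀ x, (inner ℂ (f' x) (f' x)).re = ‖f' x‖ ^ 2 := fun x => by
      have := norm_sq_eq_re_inner (𝕜 := ℂ) (f' x)
      simpa using this.symm
    simp_rw [this]
    ring
  rw [e] at h3
  refine h3.congr fun n => ?_
  have hre : Integrable (fun x => (inner ℂ (f' x) (f n x)).re) μ :=
    (integrable_inner_of_memLp hf' (hf n)).re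
  simp only [Function.comp_apply]
  have hdi : Integrable (fun x => ‖f n x - f' x‖ ^ 2) μ :=
    integrable_norm_sq_of_memLp ((hf n).sub hf')
  rw [← h1 _ (hf n), ← integral_const_mul, ← integral_sub (hre.const_mul 2)
    (integrable_norm_sq_of_memLp hf'), ← integral_sub (integrable_norm_sq_of_memLp (hf n))
    hdi]
  refine integral_congr_ae (Eventually.of_forall fun x => ?_)
  have := norm_sub_sq (𝕜 := ℂ) (f n x) (f' x)
  have e2 : (inner ℂ (f n x) (f' x)).re = (inner ℂ (f' x) (f n x)).re := by
    rw [← inner_conj_symm, Complex.conj_re]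
  simp only [RCLike.re_to_complex] at this
  simp only
  rw [this, e2]
  ring

end Weak

/-! ### Local compactness and Lions' lemma -/

theorem enorm_add_sq_le {F : Type*} [NormedAddCommGroup F] (a b : F) :
    ‖a + b‖ₑ ^ 2 ≤ 2 * (‖a‖ₑ ^ 2 + ‖b‖ₑ ^ 2) := by
  have h := ENNReal.rpow_add_le_mul_rpow_add_rpow ‖a‖ₑ ‖b‖ₑ (p := 2) (by norm_num)
  norm_num at h
  refine le_trans ?_ h
  gcongr
  exact enorm_add_le a b

theorem enorm_smear_le {d : ℕ} {ρ : EuclideanSpace ℝ (Fin d) → ℝ} (hρ : Continuous ρ)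
    {v : EuclideanSpace ℝ (Fin d) → ℂ} (hv : AEStronglyMeasurable v)
    (x : EuclideanSpace ℝ (Fin d)) : ‖smear ρ v x‖ₑ ≤ eLpNorm ρ 2 * eLpNorm v 2 := by
  have hmp := Measure.measurePreserving_sub_left (volume : Measure (EuclideanSpace ℝ (Fin d))) x
  have h1 : ‖smear ρ v x‖ₑ ≤ eLpNorm (ρ • fun t => v (x - t)) 1 := by
    rw [eLpNorm_one_eq_lintegral_enorm]
    exact enorm_integral_le_lintegral_enorm _
  have h2 : eLpNorm (fun t => v (x - t)) 2 = eLpNorm v 2 :=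
    eLpNorm_comp_measurePreserving hv hmp
  rw [← h2]
  exact h1.trans (eLpNorm_smul_le_mul_eLpNorm (hv.comp_measurePreserving hmp)
    hρ.aestronglyMeasurable)

theorem WeakTendsto.tendsto_smear {d : ℕ} {ρ : EuclideanSpace ℝ (Fin d) → ℝ} (hρ : Continuous ρ)
    (hc : HasCompactSupport ρ) {v : ℕ → EuclideanSpace ℝ (Fin d) → ℂ}
    (hw : WeakTendsto volume v (fun _ => 0)) (x : EuclideanSpace ℝ (Fin d)) :
    Tendsto (fun n => smear ρ (v n) x) atTop (𝓝 0) := by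
  have hk : Continuous fun t => ((ρ (x - t) : ℝ) : ℂ) := by fun_prop
  have hkc : HasCompactSupport fun t => ((ρ (x - t) : ℝ) : ℂ) :=
    (hc.comp_homeomorph (Homeomorph.subLeft x)).comp_left (g := fun s : ℝ => (s : ℂ)) (by simp)
  have h := hw _ (hk.memLp_of_hasCompactSupport hkc)
  simp only [inner_zero_right, integral_zero] at h
  refine h.congr fun n => ?_
  unfold smear
  rw [← integral_sub_left_eq_self (fun t => ρ t • v n (x - t)) volume x]
  simp [mul_comm]

/-- Rellich's theorem: a sequence that is bounded in `H^1` and converges weakly to zero in `L^2`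
converges strongly with respect to every finite measure dominated by Lebesgue measure. The sequence
is uniformly close to its mollifications, and these converge pointwise. -/
theorem tendsto_lintegral_sq_of_weakTendsto {d : ℕ} {μ : Measure (EuclideanSpace ℝ (Fin d))}
    [IsFiniteMeasure μ] (hμ : μ ≤ volume) {v : ℕ → EuclideanSpace ℝ (Fin d) → ℂ}
    {h : ℕ → EuclideanSpace ℝ (Fin d) → EuclideanSpace ℂ (Fin d)}
    (hv : ∀ n, HasWeakGradient (v n) (h n)) {M : ℝ≥0} (hM : ∀ n, eLpNorm (v n) 2 ≤ M)
    (hM' : ∀ n, eLpNorm (h n) 2 ≤ M) (hw : WeakTendsto volume v (fun _ => 0)) :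
    Tendsto (fun n => ∫⁻ x, ‖v n x‖ₑ ^ 2 ∂μ) atTop (𝓝 0) := by
  have hsplit : ∀ k n : ℕ, ∫⁻ x, ‖v n x‖ₑ ^ 2 ∂μ
      ≤ 2 * ((ENNReal.ofReal (1 / ((k : ℝ) + 1)) * M) ^ 2
        + ∫⁻ x, ‖smear (mollifier d k) (v n) x‖ₑ ^ 2 ∂μ) := fun k n => by
    have m1 := aestronglyMeasurable_smear k (hv n).1
    calc ∫⁻ x, ‖v n x‖ₑ ^ 2 ∂μ
        ≤ ∫⁻ x, 2 * (‖v n x - smear (mollifier d k) (v n) x‖ₑ ^ 2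
            + ‖smear (mollifier d k) (v n) x‖ₑ ^ 2) ∂μ := by
          refine lintegral_mono fun x => ?_
          have := enorm_add_sq_le (v n x - smear (mollifier d k) (v n) x)
            (smear (mollifier d k) (v n) x)
          rwa [sub_add_cancel] at this
      _ = 2 * ((∫⁻ x, ‖v n x - smear (mollifier d k) (v n) x‖ₑ ^ 2 ∂μ)
            + ∫⁻ x, ‖smear (mollifier d k) (v n) x‖ₑ ^ 2 ∂μ) := by
          rw [lintegral_const_mul' _ _ (by simp), lintegral_add_right']
          exact (m1.mono_measure hμ).enorm.pow_const 2
      _ ≤ _ := by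
          refine mul_le_mul' le_rfl (add_le_add ?_ le_rfl)
          refine (lintegral_mono' hμ le_rfl).trans ?_
          rw [← eLpNorm_two_sq]
          have h1 : eLpNorm (fun x => v n x - smear (mollifier d k) (v n) x) 2 volume
              ≤ ENNReal.ofReal (1 / ((k : ℝ) + 1)) * M :=
            ((hv n).eLpNorm_sub_smear_le k).trans (mul_le_mul' le_rfl (hM' n))
          exact pow_le_pow_left' h1 2
  have hmol : ∀ k, Tendsto (fun n => ∫⁻ x, ‖smear (mollifier d k) (v n) x‖ₑ ^ 2 ∂μ) atTop
      (𝓝 0) := fun k => by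
    have hρ := (contDiff_mollifier d k).continuous
    have hρL : eLpNorm (mollifier d k) 2 < ⊤ :=
      (hρ.memLp_of_hasCompactSupport (hasCompactSupport_mollifier d k)).2
    have := tendsto_lintegral_of_dominated_convergence' (μ := μ)
      (F := fun n x => ‖smear (mollifier d k) (v n) x‖ₑ ^ 2) (f := fun _ => 0)
      (fun _ => (eLpNorm (mollifier d k) 2 * M) ^ 2)
      (fun n => ((aestronglyMeasurable_smear k (hv n).1).mono_measure hμ).enorm.pow_const 2)
      (fun n => Eventually.of_forall fun x => by
        dsimp only
        gcongr
        exact (enorm_smear_le hρ (hv n).1.aestronglyMeasurable x).trans (by gcongr; exact hM n))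
      (by
        rw [lintegral_const]
        exact ENNReal.mul_ne_top (ENNReal.pow_ne_top (ENNReal.mul_ne_top hρL.ne (by simp)))
          (measure_ne_top _ _))
      (Eventually.of_forall fun x => by
        have h1 := (hw.tendsto_smear hρ (hasCompactSupport_mollifier d k) x).enorm
        have h2 := ((ENNReal.continuous_pow 2).tendsto _).comp h1
        simpa [Function.comp_def] using h2)
    simpa using this
  have hk : Tendsto (fun k : ℕ => 2 * (ENNReal.ofReal (1 / ((k : ℝ) + 1)) * M) ^ 2) atTop
      (𝓝 0) := by
    have h1 : Tendsto (fun k : ℕ => ENNReal.ofReal (1 / ((k : ℝ) + 1))) atTop (𝓝 0) := by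
      have := ENNReal.tendsto_ofReal (tendsto_one_div_add_atTop_nhds_zero_nat (𝕜 := ℝ))
      simpa using this
    have h2 := ENNReal.Tendsto.mul_const h1 (b := (M : ℝ≥0∞)) (Or.inr (by simp))
    have h3 := ((ENNReal.continuous_pow 2).tendsto _).comp h2
    have h4 := ENNReal.Tendsto.const_mul (a := 2) h3 (Or.inr (by simp))
    simpa [Function.comp_def] using h4
  rw [ENNReal.tendsto_nhds_zero]
  intro ε hε
  have hε2 : 0 < ε / 2 := ENNReal.half_pos hε.ne'
  obtain ⟨k, hk'⟩ := ((ENNReal.tendsto_nhds_zero.1 hk) (ε / 2) hε2).exists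
  have h4 := ENNReal.Tendsto.const_mul (a := 2) (hmol k) (Or.inr (by simp))
  rw [mul_zero] at h4
  filter_upwards [(ENNReal.tendsto_nhds_zero.1 h4) (ε / 2) hε2] with n hn
  refine (hsplit k n).trans ?_
  rw [mul_add]
  exact (add_le_add hk' hn).trans (ENNReal.add_halves ε).le

/-- Under the hypotheses of Rellich's theorem a subsequence converges almost everywhere. -/
theorem exists_ae_tendsto_of_weakTendsto {d : ℕ} {v : ℕ → EuclideanSpace ℝ (Fin d) → ℂ}
    {h : ℕ → EuclideanSpace ℝ (Fin d) → EuclideanSpace ℂ (Fin d)}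
    (hv : ∀ n, HasWeakGradient (v n) (h n)) {M : ℝ≥0} (hM : ∀ n, eLpNorm (v n) 2 ≤ M)
    (hM' : ∀ n, eLpNorm (h n) 2 ≤ M) (hw : WeakTendsto volume v (fun _ => 0)) :
    ∃ ns : ℕ → ℕ, StrictMono ns ∧ ∀ᵐ x, Tendsto (fun n => v (ns n) x) atTop (𝓝 0) := by
  -- a finite measure that is dominated by Lebesgue measure and has the same null sets
  obtain ⟨w, hw0, hwm, hwi⟩ := exists_pos_lintegral_lt_of_sigmaFinite
    (volume : Measure (EuclideanSpace ℝ (Fin d))) one_ne_zero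
  set μ := (volume : Measure (EuclideanSpace ℝ (Fin d))).withDensity
    (fun x => ((min (w x) 1 : ℝ≥0) : ℝ≥0∞)) with hμ
  have hwm' : Measurable fun x => ((min (w x) 1 : ℝ≥0) : ℝ≥0∞) :=
    (hwm.min measurable_const).coe_nnreal_ennreal
  have hle : μ ≤ volume := by
    conv_rhs => rw [← withDensity_one (μ := (volume : Measure (EuclideanSpace ℝ (Fin d))))]
    refine withDensity_mono (Eventually.of_forall fun x => ?_)
    simp only [Pi.one_apply]
    exact_mod_cast min_le_right _ _
  have hfin : IsFiniteMeasure μ := by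
    refine isFiniteMeasure_withDensity (ne_top_of_le_ne_top (hwi.trans ENNReal.one_lt_top).ne ?_)
    exact lintegral_mono fun x => ENNReal.coe_le_coe.2 (min_le_left _ _)
  have hac : (volume : Measure (EuclideanSpace ℝ (Fin d))) ≪ μ := by
    refine withDensity_absolutelyContinuous' hwm'.aemeasurable (Eventually.of_forall fun x => ?_)
    have : 0 < min (w x) 1 := lt_min (hw0 x) one_pos
    exact_mod_cast this.ne'
  have h1 := tendsto_lintegral_sq_of_weakTendsto hle hv hM hM' hw
  have h2 : Tendsto (fun n => eLpNorm (v n - fun _ => 0) 2 μ) atTop (𝓝 0) := by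
    have h3 : Tendsto (fun n => (∫⁻ x, ‖v n x‖ₑ ^ 2 ∂μ) ^ (1 / 2 : ℝ)) atTop (𝓝 0) := by
      have := ((ENNReal.continuous_rpow_const (y := 1 / 2)).tendsto _).comp h1
      simpa [Function.comp_def] using this
    refine h3.congr fun n => ?_
    have e : (v n - fun _ => 0) = v n := sub_zero (v n)
    rw [e, ← eLpNorm_two_sq, ← ENNReal.rpow_natCast, ← ENNReal.rpow_mul]
    norm_num
  have h3 := tendstoInMeasure_of_tendsto_eLpNorm two_ne_zero
    (fun n => ((hv n).1.aestronglyMeasurable.mono_measure hle)) aestronglyMeasurable_const h2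
  obtain ⟨ns, hns, hlim⟩ := h3.exists_seq_tendsto_ae
  exact ⟨ns, hns, hac.ae_le hlim⟩

theorem lintegral_lintegral_sub_mul {d : ℕ} {k F : EuclideanSpace ℝ (Fin d) → ℝ≥0∞}
    (hk : Measurable k) (hF : AEMeasurable F) :
    ∫⁻ y, ∫⁻ x, k (x - y) * F x = (∫⁻ x, k x) * ∫⁻ x, F x := by
  rw [lintegral_lintegral_swap]
  · rw [← lintegral_const_mul'' _ hF]
    congr 1
    ext x
    have hk' : Measurable fun y => k (x - y) := hk.comp (measurable_const.sub measurable_id)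
    rw [lintegral_mul_const _ hk',
      lintegral_sub_left_eq_self (fun y => k y) x]
  · exact (hk.comp (measurable_snd.sub measurable_fst)).aemeasurable.mul hF.comp_snd

/-- Hölder's inequality between the exponents `2` and `2d / (d - 2)`. -/
theorem lintegral_rpow_le_of_critExp {d : ℕ} (hd : 3 ≤ d) {f : EuclideanSpace ℝ (Fin d) → ℂ}
    (hf : AEStronglyMeasurable f) :
    ∫⁻ x, ‖f x‖ₑ ^ (2 + 4 / (d : ℝ)) ≤ (∫⁻ x, ‖f x‖ₑ ^ 2) ^ (2 / (d : ℝ))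
      * eLpNorm f (ENNReal.ofReal (critExp d)) ^ 2 := by
  have hd' : (3 : ℝ) ≤ d := by exact_mod_cast hd
  have hq := two_lt_critExp hd
  have h2d : 2 / (d : ℝ) + (1 - 2 / (d : ℝ)) = 1 := by ring
  have h1 : 0 ≤ 1 - 2 / (d : ℝ) := by
    rw [sub_nonneg, div_le_one (by linarith)]
    linarith
  have h2 : 0 ≤ 2 / (d : ℝ) := by positivity
  have key := ENNReal.lintegral_mul_norm_pow_le (μ := volume) (f := fun x => ‖f x‖ₑ ^ 2)
    (g := fun x => ‖f x‖ₑ ^ critExp d) (hf.enorm.pow_const 2) (hf.enorm.pow_const _) h2 h1 h2d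
  have hexp : critExp d * (1 - 2 / (d : ℝ)) = 2 := by
    unfold critExp
    have : (d : ℝ) - 2 ≠ 0 := by linarith
    field_simp
  have e1 : ∀ x, (‖f x‖ₑ ^ 2) ^ (2 / (d : ℝ)) * (‖f x‖ₑ ^ critExp d) ^ (1 - 2 / (d : ℝ))
      = ‖f x‖ₑ ^ (2 + 4 / (d : ℝ)) := fun x => by
    rw [← ENNReal.rpow_mul, hexp, ← ENNReal.rpow_natCast, ← ENNReal.rpow_mul,
      ← ENNReal.rpow_add_of_nonneg _ _ (by positivity) (by norm_num)]
    congr 1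
    push_cast
    ring
  have e2 : (∫⁻ x, ‖f x‖ₑ ^ critExp d) ^ (1 - 2 / (d : ℝ))
      = eLpNorm f (ENNReal.ofReal (critExp d)) ^ 2 := by
    rw [eLpNorm_eq_lintegral_rpow_enorm_toReal (by simp; linarith) (by simp),
      ENNReal.toReal_ofReal (by linarith), ← ENNReal.rpow_natCast, ← ENNReal.rpow_mul]
    congr 1
    rw [div_mul_eq_mul_div, eq_div_iff (by linarith), mul_comm, hexp]
    norm_num
  simp_rw [e1] at key
  rwa [e2] at key

/-- Lions' lemma, quantitatively: a function of `H^1` whose local `L^2` masses are all small is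
small in `L^{2 + 4/d}`. The Sobolev inequality is applied to the localizations at all points `y`,
and the result is integrated in `y`. -/
theorem exists_lions {d : ℕ} (hd : 3 ≤ d) :
    ∃ C : ℝ≥0∞, C ≠ ⊤ ∧ ∀ (u : EuclideanSpace ℝ (Fin d) → ℂ)
      (g : EuclideanSpace ℝ (Fin d) → EuclideanSpace ℂ (Fin d)), HasWeakGradient u g →
      ∀ A : ℝ≥0∞, (∀ y, ∫⁻ x, ‖unitBump d (x - y) • u x‖ₑ ^ 2 ≤ A) →
        ∫⁻ x, ‖u x‖ₑ ^ (2 + 4 / (d : ℝ))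
          ≤ C * (A ^ (2 / (d : ℝ)) * ((∫⁻ x, ‖g x‖ₑ ^ 2) + ∫⁻ x, ‖u x‖ₑ ^ 2)) := by
  obtain ⟨S, hS⟩ := exists_sobolev hd
  have hd' : (3 : ℝ) ≤ d := by exact_mod_cast hd
  have hχ : ContDiff ℝ ((⊤ : ℕ∞) : WithTop ℕ∞) (unitBump d) := (unitBump d).contDiff
  have hχc := (unitBump d).hasCompactSupport
  set q : ℝ := 2 + 4 / (d : ℝ) with hq
  have hq0 : 0 < q := by positivity
  set c := ∫⁻ x, ‖unitBump d x‖ₑ ^ q with hc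
  set a := ∫⁻ x, ‖unitBump d x‖ₑ ^ 2 with ha
  set b := ∫⁻ x, ‖realGrad (unitBump d) x‖ₑ ^ 2 with hb
  have hc0 : c ≠ 0 := by
    intro h0
    have hm : Measurable fun x => ‖unitBump d x‖ₑ ^ q :=
      (hχ.continuous.measurable.enorm).pow_const q
    have h1 := (lintegral_eq_zero_iff hm).1 h0
    have h2 : volume (Metric.ball (0 : EuclideanSpace ℝ (Fin d)) 1) = 0 := by
      refine measure_mono_null (fun x hx => ?_) (ae_iff.1 h1)
      have : unitBump d x = 1 :=
        (unitBump d).one_of_mem_closedBall (Metric.ball_subset_closedBall hx)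
      simp [this]
    exact (Metric.measure_ball_pos volume _ one_pos).ne' h2
  have hct : c ≠ ⊤ := by
    have h1 := lintegral_rpow_enorm_lt_top_of_eLpNorm_lt_top (p := ENNReal.ofReal q)
      (by simpa using hq0) (by simp)
      (hχ.continuous.memLp_of_hasCompactSupport (μ := volume) hχc).2
    rw [ENNReal.toReal_ofReal hq0.le] at h1
    exact h1.ne
  have hat : a ≠ ⊤ := by
    rw [ha, ← eLpNorm_two_sq]
    exact ENNReal.pow_ne_top (hχ.continuous.memLp_of_hasCompactSupport (μ := volume) hχc).2.ne
  have hbt : b ≠ ⊤ := by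
    rw [hb, ← eLpNorm_two_sq]
    exact ENNReal.pow_ne_top ((continuous_realGrad hχ).memLp_of_hasCompactSupport (μ := volume)
      (hasCompactSupport_realGrad hχc)).2.ne
  refine ⟨c⁻¹ * ((S : ℝ≥0∞) ^ 2 * (2 * (2 * a + 2 * b))), ?_, fun u g hu A hA => ?_⟩
  · refine ENNReal.mul_ne_top (ENNReal.inv_ne_top.2 hc0) (ENNReal.mul_ne_top (by simp) ?_)
    exact ENNReal.mul_ne_top (by simp) (ENNReal.add_ne_top.2
      ⟨ENNReal.mul_ne_top (by simp) hat, ENNReal.mul_ne_top (by simp) hbt⟩)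
  have hum := hu.1.aestronglyMeasurable
  have hgm := hu.2.1.aestronglyMeasurable
  -- the estimate for one localization
  have hloc : ∀ y, ∫⁻ x, ‖unitBump d (x - y)‖ₑ ^ q * ‖u x‖ₑ ^ q
      ≤ A ^ (2 / (d : ℝ)) * ((S : ℝ≥0∞) ^ 2 * (2 * (2 * (
        ∫⁻ x, ‖unitBump d (x - y)‖ₑ ^ 2 * ‖g x‖ₑ ^ 2)
        + (2 * (∫⁻ x, ‖realGrad (unitBump d) (x - y)‖ₑ ^ 2 * ‖u x‖ₑ ^ 2)
        + ∫⁻ x, ‖unitBump d (x - y)‖ₑ ^ 2 * ‖u x‖ₑ ^ 2)))) := fun y => by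
    have hχy : ContDiff ℝ ((⊤ : ℕ∞) : WithTop ℕ∞) (fun x => unitBump d (x - y)) :=
      hχ.comp (contDiff_id.sub contDiff_const)
    have hgy : ∀ x, realGrad (fun x => unitBump d (x - y)) x = realGrad (unitBump d) (x - y) :=
      fun x => by simp [realGrad, fderiv_comp_sub]
    have hwy := hu.smul_smooth hχy
    simp_rw [hgy] at hwy
    have h1 := lintegral_rpow_le_of_critExp hd hwy.1.aestronglyMeasurable
    have e1 : ∀ x, ‖unitBump d (x - y) • u x‖ₑ ^ q
        = ‖unitBump d (x - y)‖ₑ ^ q * ‖u x‖ₑ ^ q := fun x => by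
      rw [enorm_smul, ENNReal.mul_rpow_of_nonneg _ _ hq0.le]
    rw [← hq] at h1
    simp_rw [e1] at h1
    refine h1.trans ?_
    gcongr ?_ ^ _ * ?_
    · exact hA y
    have h2 := hS _ _ hwy
    have hsq : ∀ s t : ℝ≥0∞, (s + t) ^ 2 ≤ 2 * (s ^ 2 + t ^ 2) := fun s t => by
      have h := ENNReal.rpow_add_le_mul_rpow_add_rpow s t (p := 2) (by norm_num)
      norm_num at h
      exact h
    calc _ ≤ ((S : ℝ≥0∞) * _) ^ 2 := by gcongr
      _ ≤ (S : ℝ≥0∞) ^ 2 * (2 * (_ + _)) := by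
        rw [mul_pow]
        gcongr
        exact hsq _ _
      _ ≤ _ := by
        rw [eLpNorm_two_sq, eLpNorm_two_sq]
        gcongr (S : ℝ≥0∞) ^ 2 * (2 * ?_)
        rw [← add_assoc]
        gcongr ?_ + ?_
        · rw [← mul_add, ← lintegral_add_left', ← lintegral_const_mul' _ _ (by simp)]
          · refine lintegral_mono fun x => (enorm_add_sq_le _ _).trans (le_of_eq ?_)
            rw [enorm_smul, enorm_smul, mul_pow, mul_pow, mul_comm (‖u x‖ₑ ^ 2)]
          · exact ((hχy.continuous.aestronglyMeasurable.enorm.pow_const 2)).mul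
              (hgm.enorm.pow_const 2)
        · refine lintegral_mono fun x => le_of_eq ?_
          rw [enorm_smul, mul_pow]
  have mχ : Measurable fun x => ‖unitBump d x‖ₑ ^ 2 :=
    (hχ.continuous.measurable.enorm).pow_const 2
  have mχ' : Measurable fun x => ‖realGrad (unitBump d) x‖ₑ ^ 2 :=
    ((continuous_realGrad hχ).measurable.enorm).pow_const 2
  have mu : AEMeasurable fun x => ‖u x‖ₑ ^ 2 := hum.enorm.pow_const 2
  have mg : AEMeasurable fun x => ‖g x‖ₑ ^ 2 := hgm.enorm.pow_const 2
  have meas : ∀ {k F : EuclideanSpace ℝ (Fin d) → ℝ≥0∞}, Measurable k → AEMeasurable F →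
      AEMeasurable fun y => ∫⁻ x, k (x - y) * F x := fun {k F} hk hF =>
    ((hk.comp (measurable_snd.sub measurable_fst)).aemeasurable.mul hF.comp_snd :
      AEMeasurable (fun z : EuclideanSpace ℝ (Fin d) × EuclideanSpace ℝ (Fin d) =>
        k (z.2 - z.1) * F z.2) (volume.prod volume)).lintegral_prod_right'
  have htot : c * ∫⁻ x, ‖u x‖ₑ ^ q
      ≤ A ^ (2 / (d : ℝ)) * ((S : ℝ≥0∞) ^ 2 * (2 * (2 * (a * ∫⁻ x, ‖g x‖ₑ ^ 2)
        + (2 * (b * ∫⁻ x, ‖u x‖ₑ ^ 2) + a * ∫⁻ x, ‖u x‖ₑ ^ 2)))) := by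
    have i1 := meas mχ mg
    have i2 := meas mχ' mu
    have i3 := meas mχ mu
    have j1 := i1.const_mul 2
    have j2 : AEMeasurable (fun y => 2 * (∫⁻ x, ‖realGrad (unitBump d) (x - y)‖ₑ ^ 2 * ‖u x‖ₑ ^ 2)
        + ∫⁻ x, ‖unitBump d (x - y)‖ₑ ^ 2 * ‖u x‖ₑ ^ 2) := (i2.const_mul 2).add i3
    have j3 : AEMeasurable (fun y => 2 * (∫⁻ x, ‖unitBump d (x - y)‖ₑ ^ 2 * ‖g x‖ₑ ^ 2)
        + (2 * (∫⁻ x, ‖realGrad (unitBump d) (x - y)‖ₑ ^ 2 * ‖u x‖ₑ ^ 2)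
        + ∫⁻ x, ‖unitBump d (x - y)‖ₑ ^ 2 * ‖u x‖ₑ ^ 2)) := j1.add j2
    rw [hc, ← lintegral_lintegral_sub_mul ((hχ.continuous.measurable.enorm).pow_const q)
      (hum.enorm.pow_const q), ha, hb, ← lintegral_lintegral_sub_mul mχ mg,
      ← lintegral_lintegral_sub_mul mχ' mu, ← lintegral_lintegral_sub_mul mχ mu,
      ← lintegral_const_mul'' _ i1, ← lintegral_const_mul'' _ i2,
      ← lintegral_add_left' (i2.const_mul 2), ← lintegral_add_left' j1,
      ← lintegral_const_mul'' _ j3, ← lintegral_const_mul'' _ (j3.const_mul 2),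
      ← lintegral_const_mul'' _ ((j3.const_mul 2).const_mul _)]
    exact lintegral_mono hloc
  calc ∫⁻ x, ‖u x‖ₑ ^ q = c⁻¹ * (c * ∫⁻ x, ‖u x‖ₑ ^ q) := by
        rw [← mul_assoc, ENNReal.inv_mul_cancel hc0 hct, one_mul]
    _ ≤ c⁻¹ * (A ^ (2 / (d : ℝ)) * ((S : ℝ≥0∞) ^ 2 * (2 * (2 * (a * ∫⁻ x, ‖g x‖ₑ ^ 2)
        + (2 * (b * ∫⁻ x, ‖u x‖ₑ ^ 2) + a * ∫⁻ x, ‖u x‖ₑ ^ 2))))) := by gcongr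
    _ ≤ c⁻¹ * (A ^ (2 / (d : ℝ)) * ((S : ℝ≥0∞) ^ 2 * (2 * ((2 * a + 2 * b)
        * ((∫⁻ x, ‖g x‖ₑ ^ 2) + ∫⁻ x, ‖u x‖ₑ ^ 2))))) := by
        gcongr
        set G := ∫⁻ x, ‖g x‖ₑ ^ 2
        set U := ∫⁻ x, ‖u x‖ₑ ^ 2
        calc 2 * (a * G) + (2 * (b * U) + a * U)
            ≤ 2 * (a * G) + (2 * (b * U) + a * U) + (a * U + 2 * (b * G)) := le_self_add
          _ = _ := by ring
    _ = _ := by ring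

/-! ### The norms as integrals, and scaling -/

theorem lpNorm_two_sq {X F : Type*} [MeasurableSpace X] [NormedAddCommGroup F] {μ : Measure X}
    {f : X → F} (hf : AEStronglyMeasurable f μ) : lpNorm f 2 μ ^ 2 = ∫ x, ‖f x‖ ^ 2 ∂μ := by
  rw [lpNorm_eq_integral_norm_rpow_toReal two_ne_zero (by simp) hf]
  have h0 : 0 ≤ ∫ x, ‖f x‖ ^ 2 ∂μ := integral_nonneg fun x => by positivity
  simp only [ENNReal.toReal_ofNat, Real.rpow_ofNat]
  rw [← Real.rpow_natCast, ← Real.rpow_mul h0]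
  norm_num

theorem normL_rpow {d : ℕ} {q : ℝ} (hq : 0 < q) {u : EuclideanSpace ℝ (Fin d) → ℂ}
    (hu : AEStronglyMeasurable u) : normL q u ^ q = ∫ x, ‖u x‖ ^ q := by
  unfold normL
  rw [lpNorm_eq_integral_norm_rpow_toReal (by simpa using hq) (by simp) hu,
    ENNReal.toReal_ofReal hq.le, ← Real.rpow_mul (integral_nonneg fun x => by positivity),
    inv_mul_cancel₀ hq.ne', Real.rpow_one]

theorem normL_two_sq {d : ℕ} {u : EuclideanSpace ℝ (Fin d) → ℂ}
    (hu : AEStronglyMeasurable u) : normL 2 u ^ 2 = ∫ x, ‖u x‖ ^ 2 := by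
  unfold normL
  rw [ENNReal.ofReal_ofNat, lpNorm_two_sq hu]

theorem normL_nonneg {d : ℕ} (q : ℝ) (u : EuclideanSpace ℝ (Fin d) → ℂ) : 0 ≤ normL q u :=
  lpNorm_nonneg

theorem gradNorm_nonneg {d : ℕ} (u : EuclideanSpace ℝ (Fin d) → ℂ) : 0 ≤ gradNorm u :=
  lpNorm_nonneg

theorem HasWeakGradient.gradNorm_eq {d : ℕ} {u : EuclideanSpace ℝ (Fin d) → ℂ}
    {g : EuclideanSpace ℝ (Fin d) → EuclideanSpace ℂ (Fin d)} (hu : HasWeakGradient u g) :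
    gradNorm u = lpNorm g 2 volume := by
  have hm := hu.2.1.aestronglyMeasurable
  unfold gradNorm
  rw [← toReal_eLpNorm hm, ← toReal_eLpNorm (hm.congr hu.weakGrad_ae_eq.symm),
    eLpNorm_congr_ae hu.weakGrad_ae_eq]

theorem HasWeakGradient.gradNorm_sq {d : ℕ} {u : EuclideanSpace ℝ (Fin d) → ℂ}
    {g : EuclideanSpace ℝ (Fin d) → EuclideanSpace ℂ (Fin d)} (hu : HasWeakGradient u g) :
    gradNorm u ^ 2 = ∫ x, ‖g x‖ ^ 2 := by
  rw [hu.gradNorm_eq, lpNorm_two_sq hu.2.1.aestronglyMeasurable]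

theorem normL_smul {d : ℕ} (q c : ℝ) (u : EuclideanSpace ℝ (Fin d) → ℂ) :
    normL q (fun x => c • u x) = |c| * normL q u := by
  have := lpNorm_const_smul (p := ENNReal.ofReal q) c u
    (volume : Measure (EuclideanSpace ℝ (Fin d)))
  simpa [normL] using! this

theorem gradNorm_smul {d : ℕ} (c : ℝ) {u : EuclideanSpace ℝ (Fin d) → ℂ}
    {g : EuclideanSpace ℝ (Fin d) → EuclideanSpace ℂ (Fin d)} (hu : HasWeakGradient u g) :
    gradNorm (fun x => c • u x) = |c| * gradNorm u := by
  rw [(hu.const_smul c).gradNorm_eq, hu.gradNorm_eq]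
  have := lpNorm_const_smul (p := 2) c g (volume : Measure (EuclideanSpace ℝ (Fin d)))
  simpa using! this

theorem MemH1.smul {d : ℕ} {u : EuclideanSpace ℝ (Fin d) → ℂ} (hu : MemH1 u) (c : ℝ) :
    MemH1 (fun x => c • u x) := by
  obtain ⟨h, g, hg, hg2⟩ := hu
  exact ⟨h.const_smul c, _, hg.const_smul c, hg2.const_smul c⟩

theorem MemDotH1.smul {d : ℕ} {u : EuclideanSpace ℝ (Fin d) → ℂ} (hu : MemDotH1 u) (c : ℝ) :
    MemDotH1 (fun x => c • u x) := by
  obtain ⟨h, g, hg, hg2⟩ := hu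
  exact ⟨h.const_smul c, _, hg.const_smul c, hg2.const_smul c⟩

theorem not_ae_eq_zero_smul {d : ℕ} {u : EuclideanSpace ℝ (Fin d) → ℂ} (hu : ¬ u =ᵐ[volume] 0)
    {c : ℝ} (hc : c ≠ 0) : ¬ (fun x => c • u x) =ᵐ[volume] 0 := fun h => hu <| by
  filter_upwards [h] with x hx
  simpa [hc] using hx

theorem MemH1.memDotH1 {d : ℕ} (hd : 3 ≤ d) {u : EuclideanSpace ℝ (Fin d) → ℂ} (hu : MemH1 u) :
    MemDotH1 u := by
  obtain ⟨h, g, hg, hg2⟩ := hu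
  obtain ⟨C, hC⟩ := exists_sobolev hd
  refine ⟨⟨h.1, (hC u g hg).trans_lt ?_⟩, g, hg, hg2⟩
  exact ENNReal.mul_lt_top (by simp) (ENNReal.add_lt_top.2 ⟨hg2.2, h.2⟩)

theorem integrable_rpow_of_memLp {d : ℕ} {q : ℝ} (hq : 0 < q) {u : EuclideanSpace ℝ (Fin d) → ℂ}
    (hu : MemLp u (ENNReal.ofReal q)) : Integrable (fun x => ‖u x‖ ^ q) := by
  have := hu.integrable_norm_rpow (by simpa using hq) (by simp)
  rwa [ENNReal.toReal_ofReal hq.le] at this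

theorem memLp_of_between {d : ℕ} {r s : ℝ} (hr : 2 < r) (hrs : r < s)
    {u : EuclideanSpace ℝ (Fin d) → ℂ} (h2 : MemLp u 2) (hs : MemLp u (ENNReal.ofReal s)) :
    MemLp u (ENNReal.ofReal r) := by
  obtain ⟨C, -, hC⟩ := exists_rpow_le_sq_add hr hrs one_pos
  have hr0 : 0 < r := by linarith
  rw [← integrable_norm_rpow_iff h2.1 (by simpa using hr0) (by simp),
    ENNReal.toReal_ofReal hr0.le]
  have hi := ((integrable_norm_sq_of_memLp h2).const_mul 1).add
    ((integrable_rpow_of_memLp (by linarith) hs).const_mul C)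
  refine hi.mono' (h2.1.norm.aemeasurable.pow_const r).aestronglyMeasurable
    (Eventually.of_forall fun x => ?_)
  rw [Real.norm_of_nonneg (by positivity)]
  exact hC _ (norm_nonneg _)

theorem normL_pos {d : ℕ} {q : ℝ} (hq : 0 < q) {u : EuclideanSpace ℝ (Fin d) → ℂ}
    (hu : MemLp u (ENNReal.ofReal q)) (h0 : ¬ u =ᵐ[volume] 0) : 0 < normL q u := by
  refine (normL_nonneg q u).lt_of_ne' fun h => h0 ?_
  exact (lpNorm_eq_zero hu (by simpa using hq)).1 h

/-- The bump function as an element of `H^1`. -/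
theorem exists_memH1_ne_zero (d : ℕ) :
    ∃ u : EuclideanSpace ℝ (Fin d) → ℂ, MemH1 u ∧ ¬ u =ᵐ[volume] 0 := by
  have hχ : ContDiff ℝ ((⊤ : ℕ∞) : WithTop ℕ∞) (unitBump d) := (unitBump d).contDiff
  have hχc := (unitBump d).hasCompactSupport
  have hcont : Continuous fun x => ((unitBump d x : ℝ) : ℂ) :=
    Complex.continuous_ofReal.comp hχ.continuous
  refine ⟨fun x => ((unitBump d x : ℝ) : ℂ), ⟨?_, _, hasWeakGradient_smooth hχ, ?_⟩, fun h => ?_⟩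
  · exact hcont.memLp_of_hasCompactSupport (hχc.comp_left (g := fun s : ℝ => (s : ℂ)) (by simp))
  · exact (continuous_realGrad hχ).memLp_of_hasCompactSupport (hasCompactSupport_realGrad hχc)
  · have h1 := congrFun ((hcont.ae_eq_iff_eq (μ := volume) continuous_zero).1 h) 0
    have h2 : unitBump d 0 = 1 := (unitBump d).one_of_mem_closedBall (by
      simpa using (unitBump d).rIn_pos.le)
    simp [h2] at h1

/-! ### The Sobolev quotient and the value `m_∞` -/

theorem critExp_sub_two {d : ℕ} (hd : 3 ≤ d) : (critExp d - 2) * ((d : ℝ) / 2) = critExp d := by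
  have hd' : (3 : ℝ) ≤ d := by exact_mod_cast hd
  have : (d : ℝ) - 2 ≠ 0 := by linarith
  unfold critExp
  field_simp
  ring

theorem sobolevConst_bddBelow (d : ℕ) :
    BddBelow ((fun u : EuclideanSpace ℝ (Fin d) → ℂ => gradNorm u ^ 2) ''
      {u | MemDotH1 u ∧ normL (critExp d) u = 1}) :=
  ⟨0, by rintro _ ⟨u, -, rfl⟩; positivity⟩

theorem sobolevConst_nonneg (d : ℕ) : 0 ≤ sobolevConst d :=
  Real.sInf_nonneg (by rintro _ ⟨u, -, rfl⟩; positivity)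

theorem MemDotH1.normalize {d : ℕ} {u : EuclideanSpace ℝ (Fin d) → ℂ} (hu : MemDotH1 u)
    (h0 : 0 < normL (critExp d) u) :
    MemDotH1 (fun x => (normL (critExp d) u)⁻¹ • u x) ∧
      normL (critExp d) (fun x => (normL (critExp d) u)⁻¹ • u x) = 1 := by
  refine ⟨hu.smul _, ?_⟩
  rw [normL_smul, abs_of_pos (inv_pos.2 h0), inv_mul_cancel₀ h0.ne']

theorem sobolevConst_mul_le {d : ℕ} {u : EuclideanSpace ℝ (Fin d) → ℂ} (hu : MemDotH1 u) :
    sobolevConst d * normL (critExp d) u ^ 2 ≤ gradNorm u ^ 2 := by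
  rcases (normL_nonneg (critExp d) u).eq_or_lt with h | h
  · rw [← h]
    simp only [ne_eq, OfNat.ofNat_ne_zero, not_false_eq_true, zero_pow, mul_zero]
    positivity
  · have h1 := csInf_le (sobolevConst_bddBelow d) ⟨_, hu.normalize h, rfl⟩
    obtain ⟨g, hg, -⟩ := hu.2
    have h2 : sobolevConst d ≤ (|(normL (critExp d) u)⁻¹| * gradNorm u) ^ 2 := by
      rw [← gradNorm_smul _ hg]
      exact h1
    rw [abs_of_pos (inv_pos.2 h), mul_pow, inv_pow, inv_mul_eq_div, le_div_iff₀ (by positivity)]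
      at h2
    exact h2

/-- A quantity `t` with `σ t ^ 2 ≤ t ^ (2d / (d - 2))` carries at least the critical energy. -/
theorem rpow_le_of_mul_sq_le {d : ℕ} (hd : 3 ≤ d) {σ t : ℝ} (hσ : 0 ≤ σ) (ht : 0 < t)
    (h : σ * t ^ 2 ≤ t ^ critExp d) : σ ^ ((d : ℝ) / 2) ≤ t ^ critExp d := by
  have h1 : t ^ critExp d = t ^ (critExp d - 2) * t ^ 2 := by
    rw [← Real.rpow_natCast t 2, ← Real.rpow_add ht]
    norm_num
  rw [h1] at h
  have h2 : σ ≤ t ^ (critExp d - 2) := le_of_mul_le_mul_right h (by positivity)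
  calc σ ^ ((d : ℝ) / 2) ≤ (t ^ (critExp d - 2)) ^ ((d : ℝ) / 2) :=
        Real.rpow_le_rpow hσ h2 (by positivity)
    _ = t ^ critExp d := by rw [← Real.rpow_mul ht.le, critExp_sub_two hd]

theorem critAction_eq {d : ℕ} (hd : 3 ≤ d) {u : EuclideanSpace ℝ (Fin d) → ℂ}
    (hu : u ∈ critNehariSet d) : critAction u = normL (critExp d) u ^ critExp d / d := by
  have h := hu.2.2
  unfold critNehari at h
  have hd' : (3 : ℝ) ≤ d := by exact_mod_cast hd
  unfold critAction
  rw [sub_eq_zero.1 h]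
  field_simp
  ring

/-- Rescaling a function of unit norm onto the constraint `N^‡ = 0`. -/
theorem exists_critNehari_of_unit {d : ℕ} (hd : 3 ≤ d) {u : EuclideanSpace ℝ (Fin d) → ℂ}
    (hu : MemDotH1 u) (h1 : normL (critExp d) u = 1) :
    ∃ w ∈ critNehariSet d, critAction w = (gradNorm u ^ 2) ^ ((d : ℝ) / 2) / d := by
  have hq := two_lt_critExp hd
  obtain ⟨hL, g, hg, hg2⟩ := hu
  have hne : ¬ u =ᵐ[volume] 0 := fun h => by
    have := (lpNorm_eq_zero hL (by simp; linarith)).2 h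
    unfold normL at h1
    rw [this] at h1
    exact zero_ne_one h1
  have ha : 0 < gradNorm u ^ 2 := by
    refine pow_pos ((gradNorm_nonneg u).lt_of_ne' fun h => hne ?_) 2
    rw [hg.gradNorm_eq, lpNorm_eq_zero hg2 two_ne_zero] at h
    exact hg.ae_eq_zero_of_grad (by omega) h (by simp; linarith) (by simp) hL
  set a := gradNorm u ^ 2 with hadef
  set l := a ^ (1 / (critExp d - 2)) with hl
  have hl0 : 0 < l := by positivity
  have hl2 : l ^ (critExp d - 2) = a := by
    rw [hl, ← Real.rpow_mul ha.le, one_div_mul_cancel (by linarith), Real.rpow_one]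
  have hls : l ^ critExp d = a ^ ((d : ℝ) / 2) := by
    rw [← critExp_sub_two hd, Real.rpow_mul hl0.le, hl2]
  have hQ : normL (critExp d) (fun x => l • u x) ^ critExp d = l ^ critExp d := by
    rw [normL_smul, h1, mul_one, abs_of_pos hl0]
  have hmem : (fun x => l • u x) ∈ critNehariSet d := by
    refine ⟨MemDotH1.smul ⟨hL, g, hg, hg2⟩ l, not_ae_eq_zero_smul hne hl0.ne', ?_⟩
    unfold critNehari
    rw [hQ, gradNorm_smul l hg, abs_of_pos hl0, mul_pow, ← hadef, sub_eq_zero]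
    conv_lhs => rw [← hl2]
    rw [← Real.rpow_natCast l 2, ← Real.rpow_add hl0]
    norm_num
  exact ⟨_, hmem, by rw [critAction_eq hd hmem, hQ, hls]⟩

theorem exists_unit_memDotH1 {d : ℕ} (hd : 3 ≤ d) :
    ∃ u : EuclideanSpace ℝ (Fin d) → ℂ, MemDotH1 u ∧ normL (critExp d) u = 1 := by
  obtain ⟨u, hu, h0⟩ := exists_memH1_ne_zero d
  have hu' := hu.memDotH1 hd
  exact ⟨_, hu'.normalize (normL_pos (by linarith [two_lt_critExp hd]) hu'.1 h0)⟩

theorem mInfty_eq {d : ℕ} (hd : 3 ≤ d) : mInfty d = sobolevConst d ^ ((d : ℝ) / 2) / d := by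
  have hd' : (3 : ℝ) ≤ d := by exact_mod_cast hd
  have hq := two_lt_critExp hd
  obtain ⟨u₀, hu₀, h₀⟩ := exists_unit_memDotH1 hd
  obtain ⟨w₀, hw₀, -⟩ := exists_critNehari_of_unit hd hu₀ h₀
  refine le_antisymm ?_ ?_
  · have hm0 : 0 ≤ mInfty d := by
      refine Real.sInf_nonneg ?_
      rintro _ ⟨u, hu, rfl⟩
      rw [critAction_eq hd hu]
      have := normL_nonneg (critExp d) u
      positivity
    have hle : (d * mInfty d) ^ (2 / (d : ℝ)) ≤ sobolevConst d := by
      refine le_csInf ⟨_, u₀, ⟨hu₀, h₀⟩, rfl⟩ ?_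
      rintro _ ⟨u, ⟨hu, h1⟩, rfl⟩
      obtain ⟨w, hw, hwe⟩ := exists_critNehari_of_unit hd hu h1
      have h2 : mInfty d ≤ critAction w := csInf_le (bddBelow_critAction hd) ⟨w, hw, rfl⟩
      rw [hwe, le_div_iff₀ (by linarith), mul_comm] at h2
      calc (d * mInfty d) ^ (2 / (d : ℝ))
          ≤ ((gradNorm u ^ 2) ^ ((d : ℝ) / 2)) ^ (2 / (d : ℝ)) :=
            Real.rpow_le_rpow (by positivity) h2 (by positivity)
        _ = gradNorm u ^ 2 := by
            rw [← Real.rpow_mul (by positivity)]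
            have : (d : ℝ) / 2 * (2 / d) = 1 := by field_simp
            rw [this, Real.rpow_one]
    rw [le_div_iff₀ (by linarith), mul_comm]
    calc d * mInfty d = ((d * mInfty d) ^ (2 / (d : ℝ))) ^ ((d : ℝ) / 2) := by
          rw [← Real.rpow_mul (by positivity)]
          have : 2 / (d : ℝ) * (d / 2) = 1 := by field_simp
          rw [this, Real.rpow_one]
      _ ≤ sobolevConst d ^ ((d : ℝ) / 2) :=
          Real.rpow_le_rpow (by positivity) hle (by positivity)
  · refine le_csInf ⟨_, w₀, hw₀, rfl⟩ ?_
    rintro _ ⟨u, hu, rfl⟩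
    rw [critAction_eq hd hu]
    have hpos := normL_pos (by linarith) hu.1.1 hu.2.1
    have h1 := sobolevConst_mul_le hu.1
    have h2 := hu.2.2
    unfold critNehari at h2
    rw [sub_eq_zero.1 h2] at h1
    gcongr
    exact rpow_le_of_mul_sq_le hd (sobolevConst_nonneg d) hpos h1

/-! ### The Nehari constraint -/

/-- The action minus half of Nehari's functional. It has no gradient term, and it coincides with the
action on the Nehari set. -/
def reducedAction {d : ℕ} (p : ℝ) (u : EuclideanSpace ℝ (Fin d) → ℂ) : ℝ :=
  (1 / 2 - 1 / (p + 1)) * normL (p + 1) u ^ (p + 1) + normL (critExp d) u ^ critExp d / d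

theorem action_eq {d : ℕ} (hd : 3 ≤ d) (p ω : ℝ) (u : EuclideanSpace ℝ (Fin d) → ℂ) :
    action p ω u = reducedAction p u + nehari p ω u / 2 := by
  have hd' : (3 : ℝ) ≤ d := by exact_mod_cast hd
  unfold action reducedAction nehari
  have : (d : ℝ) ≠ 0 := by linarith
  have e : ((d : ℝ) - 2) / (2 * d) = 1 / 2 - 1 / d := by field_simp
  rw [e]
  ring

theorem add_one_lt_critExp {d : ℕ} (hd : 3 ≤ d) {p : ℝ}
    (hp : p < ((d : ℝ) + 2) / ((d : ℝ) - 2)) : p + 1 < critExp d := by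
  have hd' : (3 : ℝ) ≤ d := by exact_mod_cast hd
  have : (d : ℝ) - 2 ≠ 0 := by linarith
  have e : critExp d = ((d : ℝ) + 2) / ((d : ℝ) - 2) + 1 := by
    unfold critExp
    field_simp
    ring
  rw [e]
  linarith

theorem half_sub_pos {p : ℝ} (hp : 1 < p) : 0 < 1 / 2 - 1 / (p + 1) := by
  rw [sub_pos]
  exact one_div_lt_one_div_of_lt (by norm_num) (by linarith)

theorem reducedAction_nonneg {d : ℕ} {p : ℝ} (hp : 1 < p)
    (u : EuclideanSpace ℝ (Fin d) → ℂ) : 0 ≤ reducedAction p u := by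
  have h1 := half_sub_pos hp
  have h2 := normL_nonneg (p + 1) u
  have h3 := normL_nonneg (critExp d) u
  unfold reducedAction
  positivity

theorem nehari_smul {d : ℕ} {p ω c : ℝ} (hc : 0 ≤ c) {u : EuclideanSpace ℝ (Fin d) → ℂ}
    (hu : MemH1 u) : nehari p ω (fun x => c • u x) =
      c ^ 2 * (gradNorm u ^ 2 + ω * normL 2 u ^ 2) - c ^ (p + 1) * normL (p + 1) u ^ (p + 1)
        - c ^ critExp d * normL (critExp d) u ^ critExp d := by
  obtain ⟨-, g, hg, -⟩ := hu
  unfold nehari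
  rw [gradNorm_smul c hg, normL_smul, normL_smul, normL_smul, abs_of_nonneg hc,
    Real.mul_rpow hc (normL_nonneg _ _), Real.mul_rpow hc (normL_nonneg _ _)]
  ring

theorem reducedAction_smul {d : ℕ} {p c : ℝ} (hc : 0 ≤ c)
    (u : EuclideanSpace ℝ (Fin d) → ℂ) : reducedAction p (fun x => c • u x) =
      (1 / 2 - 1 / (p + 1)) * (c ^ (p + 1) * normL (p + 1) u ^ (p + 1))
        + c ^ critExp d * normL (critExp d) u ^ critExp d / d := by
  unfold reducedAction
  rw [normL_smul, normL_smul, abs_of_nonneg hc,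
    Real.mul_rpow hc (normL_nonneg _ _), Real.mul_rpow hc (normL_nonneg _ _)]

theorem exists_balance {a b H P Q T : ℝ} (ha : 0 < a) (hb : 0 < b) (hH : 0 < H) (hT : 0 < T)
    (h : H ≤ T ^ a * P + T ^ b * Q) :
    ∃ l, 0 < l ∧ l ≤ T ∧ l ^ a * P + l ^ b * Q = H := by
  have hcont : ContinuousOn (fun l : ℝ => l ^ a * P + l ^ b * Q) (Set.Icc 0 T) := by
    refine Continuous.continuousOn ?_
    exact ((Real.continuous_rpow_const ha.le).mul continuous_const).add
      ((Real.continuous_rpow_const hb.le).mul continuous_const)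
  have h0 : (0 : ℝ) ^ a * P + (0 : ℝ) ^ b * Q = 0 := by
    simp [Real.zero_rpow ha.ne', Real.zero_rpow hb.ne']
  obtain ⟨l, hl, hle⟩ := intermediate_value_Icc hT.le hcont ⟨h0.trans_le hH.le, h⟩
  refine ⟨l, hl.1.lt_of_ne' fun h' => ?_, hl.2, hle⟩
  simp only at hle
  rw [h', h0] at hle
  exact hH.ne hle

/-- Rescaling onto the Nehari set: it is enough that the nonlinear terms dominate at the scale
`T`. -/
theorem exists_smul_mem_nehariSet {d : ℕ} (hd : 3 ≤ d) {p ω : ℝ} (hp : 1 < p) (hω : 0 < ω)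
    {u : EuclideanSpace ℝ (Fin d) → ℂ} (hu : MemH1 u) (h0 : ¬ u =ᵐ[volume] 0) {T : ℝ}
    (hT : 0 < T) (h : gradNorm u ^ 2 + ω * normL 2 u ^ 2
      ≤ T ^ (p - 1) * normL (p + 1) u ^ (p + 1)
        + T ^ (critExp d - 2) * normL (critExp d) u ^ critExp d) :
    ∃ l, 0 < l ∧ l ≤ T ∧ (fun x => l • u x) ∈ nehariSet d p ω := by
  have hq := two_lt_critExp hd
  have h2 : 0 < normL 2 u := normL_pos two_pos (by simpa using hu.1) h0
  have hH : 0 < gradNorm u ^ 2 + ω * normL 2 u ^ 2 := by positivity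
  obtain ⟨l, hl0, hlT, hl⟩ := exists_balance (by linarith) (by linarith) hH hT h
  refine ⟨l, hl0, hlT, hu.smul l, not_ae_eq_zero_smul h0 hl0.ne', ?_⟩
  rw [nehari_smul hl0.le hu, ← hl]
  have e1 : l ^ (p + 1) = l ^ 2 * l ^ (p - 1) := by
    rw [← Real.rpow_natCast l 2, ← Real.rpow_add hl0]
    congr 1
    push_cast
    ring
  have e2 : l ^ critExp d = l ^ 2 * l ^ (critExp d - 2) := by
    rw [← Real.rpow_natCast l 2, ← Real.rpow_add hl0]
    congr 1
    push_cast
    ring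
  rw [e1, e2]
  ring

theorem nehariSet_nonempty {d : ℕ} (hd : 3 ≤ d) {p ω : ℝ} (hp : 1 < p) (hω : 0 < ω) :
    (nehariSet d p ω).Nonempty := by
  obtain ⟨u, hu, h0⟩ := exists_memH1_ne_zero d
  have hq := two_lt_critExp hd
  have h2 : 0 < normL 2 u := normL_pos two_pos (by simpa using hu.1) h0
  have hQ : 0 < normL (critExp d) u := normL_pos (by linarith) (hu.memDotH1 hd).1 h0
  have hP := normL_nonneg (p + 1) u
  set H := gradNorm u ^ 2 + ω * normL 2 u ^ 2 with hH
  have hH0 : 0 < H := by positivity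
  -- the scale at which the critical term alone balances the quadratic ones
  set T := (H / normL (critExp d) u ^ critExp d) ^ (1 / (critExp d - 2)) with hT
  have hT0 : 0 < T := by positivity
  have hTe : T ^ (critExp d - 2) * normL (critExp d) u ^ critExp d = H := by
    rw [hT, ← Real.rpow_mul (by positivity), one_div_mul_cancel (by linarith), Real.rpow_one]
    field_simp
  obtain ⟨l, -, -, hl⟩ := exists_smul_mem_nehariSet hd hp hω hu h0 hT0 (by
    rw [hTe]
    have : 0 ≤ T ^ (p - 1) * normL (p + 1) u ^ (p + 1) := by positivity
    linarith)
  exact ⟨_, hl⟩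

theorem mNehari_le_action {d : ℕ} (hd : 3 ≤ d) {p ω : ℝ} (hp : 1 < p)
    {u : EuclideanSpace ℝ (Fin d) → ℂ} (hu : u ∈ nehariSet d p ω) :
    mNehari d p ω ≤ action p ω u :=
  csInf_le (bddBelow_action hd hp ω) ⟨u, hu, rfl⟩

theorem not_ae_eq_zero_of_nehari_neg {d : ℕ} (hd : 3 ≤ d) {p ω : ℝ} (hp : 1 < p) (hω : 0 < ω)
    {u : EuclideanSpace ℝ (Fin d) → ℂ} (hN : nehari p ω u < 0) : ¬ u =ᵐ[volume] 0 := by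
  intro h
  have hq := two_lt_critExp hd
  have hz : ∀ q : ℝ, 0 < q → normL q u = 0 := fun q hq0 =>
    (lpNorm_eq_zero ((memLp_congr_ae h).2 MemLp.zero) (by simpa using hq0)).2 h
  unfold nehari at hN
  rw [hz _ (by linarith : 0 < p + 1), hz _ (by linarith : 0 < critExp d), Real.zero_rpow
    (by linarith), Real.zero_rpow (by linarith)] at hN
  have : 0 ≤ gradNorm u ^ 2 + ω * normL 2 u ^ 2 := by positivity
  linarith

/-- On the region `N_ω < 0` the reduced action exceeds `m_ω`: such functions have to be shrunk to
reach the Nehari set. -/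
theorem mNehari_lt_reducedAction {d : ℕ} (hd : 3 ≤ d) {p ω : ℝ} (hp : 1 < p) (hω : 0 < ω)
    {u : EuclideanSpace ℝ (Fin d) → ℂ} (hu : MemH1 u) (hN : nehari p ω u < 0) :
    mNehari d p ω < reducedAction p u := by
  have h0 := not_ae_eq_zero_of_nehari_neg hd hp hω hN
  have hd' : (3 : ℝ) ≤ d := by exact_mod_cast hd
  have hq := two_lt_critExp hd
  have hQ : 0 < normL (critExp d) u := normL_pos (by linarith) (hu.memDotH1 hd).1 h0
  have hP := normL_nonneg (p + 1) u
  obtain ⟨l, hl0, hl1, hl⟩ := exists_smul_mem_nehariSet hd hp hω hu h0 one_pos (by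
    unfold nehari at hN
    rw [Real.one_rpow, Real.one_rpow]
    linarith)
  have hl1' : l < 1 := by
    refine hl1.lt_of_ne fun h => ?_
    have := hl.2.2
    simp only [h, one_smul] at this
    linarith
  have h1 := mNehari_le_action hd hp hl
  rw [action_eq hd, hl.2.2, reducedAction_smul hl0.le] at h1
  have h2 : l ^ (p + 1) * normL (p + 1) u ^ (p + 1) ≤ normL (p + 1) u ^ (p + 1) :=
    mul_le_of_le_one_left (by positivity) (Real.rpow_le_one hl0.le hl1 (by linarith))
  have h3 : l ^ critExp d * normL (critExp d) u ^ critExp d / d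
      < normL (critExp d) u ^ critExp d / d := by
    gcongr
    exact mul_lt_of_lt_one_left (by positivity) (Real.rpow_lt_one hl0.le hl1' (by linarith))
  have h4 := mul_le_mul_of_nonneg_left h2 (half_sub_pos hp).le
  unfold reducedAction
  linarith

theorem isGroundState_of_le {d : ℕ} (hd : 3 ≤ d) {p ω : ℝ} (hp : 1 < p) (hω : 0 < ω)
    {u : EuclideanSpace ℝ (Fin d) → ℂ} (hu : MemH1 u) (h0 : ¬ u =ᵐ[volume] 0)
    (hN : nehari p ω u ≤ 0) (hm : reducedAction p u ≤ mNehari d p ω) : IsGroundState p ω u := by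
  have hN0 : nehari p ω u = 0 := hN.eq_or_lt.resolve_right fun h =>
    absurd (mNehari_lt_reducedAction hd hp hω hu h) (not_lt.2 hm)
  have hmem : u ∈ nehariSet d p ω := ⟨hu, h0, hN0⟩
  refine ⟨hmem, le_antisymm ?_ (mNehari_le_action hd hp hmem)⟩
  rw [action_eq hd, hN0]
  simpa using hm

/-! ### Non-vanishing of minimizing sequences -/

theorem exists_normL_rpow_le {d : ℕ} {r s : ℝ} (hr : 2 < r) (hrs : r < s) {ε : ℝ} (hε : 0 < ε) :
    ∃ C : ℝ, 0 ≤ C ∧ ∀ u : EuclideanSpace ℝ (Fin d) → ℂ, MemLp u 2 →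
      MemLp u (ENNReal.ofReal s) → normL r u ^ r ≤ ε * normL 2 u ^ 2 + C * normL s u ^ s := by
  obtain ⟨C, hC0, hC⟩ := exists_rpow_le_sq_add hr hrs hε
  refine ⟨C, hC0, fun u h2 hs => ?_⟩
  have i2 := (integrable_norm_sq_of_memLp h2).const_mul ε
  have is := (integrable_rpow_of_memLp (by linarith) hs).const_mul C
  rw [normL_rpow (by linarith) h2.1, normL_rpow (by linarith) h2.1, normL_two_sq h2.1,
    ← integral_const_mul, ← integral_const_mul, ← integral_add i2 is]
  exact integral_mono (integrable_rpow_of_memLp (by linarith) (memLp_of_between hr hrs h2 hs))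
    (i2.add is) fun x => hC _ (norm_nonneg _)

/-- If the `L^r` norm is bounded below, with `2 < r < s` and bounded `L^2` and `L^s` norms, then so
is any other intermediate norm. -/
theorem exists_le_integral_rpow {d : ℕ} {r s q : ℝ} (hr : 2 < r) (hrs : r < s) (hq : 2 < q)
    (hqs : q < s) {δ : ℝ} (hδ : 0 < δ) {K : ℝ} (hK : 0 ≤ K) :
    ∃ η : ℝ, 0 < η ∧ ∀ u : EuclideanSpace ℝ (Fin d) → ℂ, MemLp u 2 →
      MemLp u (ENNReal.ofReal s) → normL 2 u ^ 2 + normL s u ^ s ≤ K → δ ≤ normL r u ^ r →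
      η ≤ ∫ x, ‖u x‖ ^ q := by
  obtain ⟨C, hC0, hC⟩ := exists_rpow_le_of_between hr hrs q (ε := δ / (2 * (K + 1)))
    (by positivity)
  refine ⟨δ / (2 * (C + 1)), by positivity, fun u h2 hs hu hur => ?_⟩
  have i2 := integrable_norm_sq_of_memLp h2
  have is := integrable_rpow_of_memLp (by linarith) hs
  have iq := integrable_rpow_of_memLp (by linarith) (memLp_of_between hq hqs h2 hs)
  have i2s : Integrable (fun x => δ / (2 * (K + 1)) * (‖u x‖ ^ 2 + ‖u x‖ ^ s)) :=
    (i2.add is).const_mul _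
  have h1 : normL r u ^ r
      ≤ δ / (2 * (K + 1)) * (normL 2 u ^ 2 + normL s u ^ s) + C * ∫ x, ‖u x‖ ^ q := by
    rw [normL_rpow (by linarith) h2.1, normL_rpow (by linarith) h2.1, normL_two_sq h2.1,
      ← integral_add i2 is, ← integral_const_mul, ← integral_const_mul,
      ← integral_add i2s (iq.const_mul _)]
    refine integral_mono (integrable_rpow_of_memLp (by linarith) (memLp_of_between hr hrs h2 hs))
      (i2s.add (iq.const_mul _)) fun x => ?_
    rcases (norm_nonneg (u x)).eq_or_lt with h | h
    · simp only
      rw [← h, Real.zero_rpow (by linarith), Real.zero_rpow (by linarith),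
        Real.zero_rpow (by linarith)]
      simp
    · exact hC _ h
  have h3 : δ / (2 * (K + 1)) * (normL 2 u ^ 2 + normL s u ^ s) ≤ δ / 2 := by
    calc _ ≤ δ / (2 * (K + 1)) * (K + 1) := by
          refine mul_le_mul_of_nonneg_left ?_ (by positivity)
          linarith
      _ = δ / 2 := by field_simp
  have h4 : 0 ≤ ∫ x, ‖u x‖ ^ q := integral_nonneg fun x => by positivity
  rw [div_le_iff₀ (by positivity)]
  nlinarith

/-- The only use of `m_ω < m_∞`: the subcritical norms along a minimizing sequence do not tend to
zero, since otherwise the sequence would asymptotically be admissible for the critical problem. -/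
theorem exists_frequently_normL_ge {d : ℕ} (hd : 3 ≤ d) {p ω : ℝ} (hp : 1 < p)
    (hp' : p < ((d : ℝ) + 2) / ((d : ℝ) - 2)) (hω : 0 < ω)
    (hm : mNehari d p ω < mInfty d) {u : ℕ → EuclideanSpace ℝ (Fin d) → ℂ}
    (hu : ∀ n, u n ∈ nehariSet d p ω)
    (hlim : Tendsto (fun n => action p ω (u n)) atTop (𝓝 (mNehari d p ω))) :
    ∃ δ : ℝ, 0 < δ ∧ ∃ᶠ n in atTop, δ ≤ normL (p + 1) (u n) ^ (p + 1) := by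
  by_contra hcon
  have hd' : (3 : ℝ) ≤ d := by exact_mod_cast hd
  have hq := two_lt_critExp hd
  set s := critExp d with hs
  have hP : Tendsto (fun n => normL (p + 1) (u n) ^ (p + 1)) atTop (𝓝 0) := by
    rw [Metric.tendsto_atTop]
    intro ε hε
    have h1 : ¬ ∃ᶠ n in atTop, ε ≤ normL (p + 1) (u n) ^ (p + 1) := fun h => hcon ⟨ε, hε, h⟩
    rw [not_frequently, eventually_atTop] at h1
    obtain ⟨N, hN⟩ := h1
    refine ⟨N, fun n hn => ?_⟩
    rw [Real.dist_eq, sub_zero, abs_of_nonneg (Real.rpow_nonneg (normL_nonneg _ _) _)]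
    exact not_le.1 (hN n hn)
  have hred : ∀ n, action p ω (u n) = reducedAction p (u n) := fun n => by
    rw [action_eq hd, (hu n).2.2]
    simp
  simp_rw [hred] at hlim
  have hQ : Tendsto (fun n => normL s (u n) ^ s) atTop (𝓝 (d * mNehari d p ω)) := by
    have h1 := (hlim.sub (hP.const_mul (1 / 2 - 1 / (p + 1)))).const_mul (d : ℝ)
    rw [mul_zero, sub_zero] at h1
    refine h1.congr fun n => ?_
    unfold reducedAction
    field_simp
    ring
  have hm0 : 0 ≤ mNehari d p ω :=
    ge_of_tendsto hlim (Eventually.of_forall fun n => reducedAction_nonneg hp (u n))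
  have hσ : 0 < sobolevConst d := by
    refine (sobolevConst_nonneg d).lt_of_ne' fun h => ?_
    rw [mInfty_eq hd, h, Real.zero_rpow (by positivity), zero_div] at hm
    linarith
  have hpos : ∀ n, 0 < normL s (u n) := fun n =>
    normL_pos (by linarith) ((hu n).1.memDotH1 hd).1 (hu n).2.1
  have hsob := fun n => sobolevConst_mul_le ((hu n).1.memDotH1 hd)
  have hN := fun n => (hu n).2.2
  unfold nehari at hN
  -- the critical norms are bounded below, by absorbing the subcritical term
  obtain ⟨C, hC0, hC⟩ := exists_normL_rpow_le (d := d) (by linarith : 2 < p + 1)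
    (add_one_lt_critExp hd hp') hω
  have hlow : ∀ n, (sobolevConst d / (C + 1)) ^ ((d : ℝ) / 2) ≤ normL s (u n) ^ s := fun n => by
    refine rpow_le_of_mul_sq_le hd (by positivity) (hpos n) ?_
    have h1 := hC (u n) (hu n).1.1 ((hu n).1.memDotH1 hd).1
    have h2 := hsob n
    have h3 := hN n
    rw [div_mul_eq_mul_div, div_le_iff₀ (by positivity)]
    linarith
  have hpos' : 0 < d * mNehari d p ω :=
    lt_of_lt_of_le (by positivity) (ge_of_tendsto hQ (Eventually.of_forall hlow))
  set t := (d * mNehari d p ω) ^ s⁻¹ with ht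
  have ht0 : 0 < t := by positivity
  have hts : t ^ s = d * mNehari d p ω := by
    rw [ht, ← Real.rpow_mul hpos'.le, inv_mul_cancel₀ (by linarith), Real.rpow_one]
  have hT : Tendsto (fun n => normL s (u n)) atTop (𝓝 t) := by
    have h1 := hQ.rpow_const (p := s⁻¹) (Or.inl hpos'.ne')
    refine h1.congr fun n => ?_
    rw [← Real.rpow_mul (hpos n).le, mul_inv_cancel₀ (by linarith), Real.rpow_one]
  have hfin : sobolevConst d * t ^ 2 ≤ t ^ s := by
    have h1 := (hT.pow 2).const_mul (sobolevConst d)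
    have h2 := hP.add hQ
    rw [zero_add, ← hts] at h2
    refine le_of_tendsto_of_tendsto' h1 h2 fun n => ?_
    have h3 := hN n
    have h4 := hsob n
    have h5 : 0 ≤ ω * normL 2 (u n) ^ 2 := by positivity
    linarith
  have h6 := rpow_le_of_mul_sq_le hd hσ.le ht0 hfin
  rw [hts] at h6
  rw [mInfty_eq hd, lt_div_iff₀ (by linarith)] at hm
  linarith

/-- Bounds for the norms on the Nehari set in terms of the action. -/
theorem norms_le_of_mem_nehariSet {d : ℕ} (hd : 3 ≤ d) {p ω : ℝ} (hp : 1 < p)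
    (hp' : p < ((d : ℝ) + 2) / ((d : ℝ) - 2))
    {u : EuclideanSpace ℝ (Fin d) → ℂ} (hu : u ∈ nehariSet d p ω) :
    (1 / 2 - 1 / (p + 1)) * (gradNorm u ^ 2 + ω * normL 2 u ^ 2) ≤ action p ω u := by
  have hd' : (3 : ℝ) ≤ d := by exact_mod_cast hd
  have hlt := add_one_lt_critExp hd hp'
  have hN := hu.2.2
  have hQ : 0 ≤ normL (critExp d) u ^ critExp d := Real.rpow_nonneg (normL_nonneg _ _) _
  have e : (1 / 2 - 1 / (p + 1)) ≤ 1 / d := by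
    have h1 : 1 / critExp d = 1 / 2 - 1 / d := by
      unfold critExp
      have : (d : ℝ) - 2 ≠ 0 := by linarith
      field_simp
    have h2 := one_div_lt_one_div_of_lt (by linarith) hlt
    linarith
  rw [action_eq hd, hN]
  unfold nehari at hN
  unfold reducedAction
  have h3 := mul_le_mul_of_nonneg_right e hQ
  have h4 : gradNorm u ^ 2 + ω * normL 2 u ^ 2
      = normL (p + 1) u ^ (p + 1) + normL (critExp d) u ^ critExp d := by linarith
  rw [h4]
  linarith [one_div_mul_eq_div (d : ℝ) (normL (critExp d) u ^ critExp d)]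

/-! ### Translations and weak limits in `H^1` -/

theorem memLp_comp_add_right {d : ℕ} {F : Type*} [NormedAddCommGroup F] {q : ℝ≥0∞}
    {f : EuclideanSpace ℝ (Fin d) → F} (hf : MemLp f q) (y : EuclideanSpace ℝ (Fin d)) :
    MemLp (fun x => f (x + y)) q :=
  hf.comp_measurePreserving (measurePreserving_add_right volume y)

theorem eLpNorm_comp_add_right {d : ℕ} {F : Type*} [NormedAddCommGroup F] (q : ℝ≥0∞)
    {f : EuclideanSpace ℝ (Fin d) → F} (hf : AEStronglyMeasurable f)
    (y : EuclideanSpace ℝ (Fin d)) : eLpNorm (fun x => f (x + y)) q = eLpNorm f q :=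
  eLpNorm_comp_measurePreserving hf (measurePreserving_add_right volume y)

theorem lpNorm_comp_add_right {d : ℕ} {F : Type*} [NormedAddCommGroup F] (q : ℝ≥0∞)
    {f : EuclideanSpace ℝ (Fin d) → F} (hf : AEStronglyMeasurable f)
    (y : EuclideanSpace ℝ (Fin d)) :
    lpNorm (fun x => f (x + y)) q volume = lpNorm f q volume := by
  have hf' : AEStronglyMeasurable (fun x => f (x + y)) volume :=
    hf.comp_measurePreserving (measurePreserving_add_right volume y)
  rw [← toReal_eLpNorm hf, ← toReal_eLpNorm hf', eLpNorm_comp_add_right q hf]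

theorem MemH1.functionals_comp_add_right {d : ℕ} (p ω : ℝ) {u : EuclideanSpace ℝ (Fin d) → ℂ}
    (hu : MemH1 u) (y : EuclideanSpace ℝ (Fin d)) :
    nehari p ω (fun x => u (x + y)) = nehari p ω u ∧
      reducedAction p (fun x => u (x + y)) = reducedAction p u := by
  obtain ⟨h, g, hg, -⟩ := hu
  have hL : ∀ q : ℝ, normL q (fun x => u (x + y)) = normL q u := fun q =>
    lpNorm_comp_add_right _ h.1 y
  unfold nehari reducedAction
  rw [(hg.comp_add_right y).gradNorm_eq, hg.gradNorm_eq, hL, hL, hL,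
    lpNorm_comp_add_right _ hg.2.1.aestronglyMeasurable y]
  exact ⟨rfl, rfl⟩

/-- Weak gradients are stable under weak `L^2` convergence. -/
theorem HasWeakGradient.of_weakTendsto {d : ℕ} {v : ℕ → EuclideanSpace ℝ (Fin d) → ℂ}
    {h : ℕ → EuclideanSpace ℝ (Fin d) → EuclideanSpace ℂ (Fin d)}
    {v' : EuclideanSpace ℝ (Fin d) → ℂ} {h' : EuclideanSpace ℝ (Fin d) → EuclideanSpace ℂ (Fin d)}
    (hv : ∀ n, HasWeakGradient (v n) (h n)) (hv' : MemLp v' 2) (hh' : MemLp h' 2)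
    (hwv : WeakTendsto volume v v') (hwh : WeakTendsto volume h h') : HasWeakGradient v' h' := by
  refine ⟨hv'.locallyIntegrable (by norm_num), hh'.locallyIntegrable (by norm_num),
    fun φ hφ hc i => ?_⟩
  have k1 : MemLp (fun x => ((fderiv ℝ φ x (EuclideanSpace.single i 1) : ℝ) : ℂ)) 2 volume :=
    (Complex.continuous_ofReal.comp
      (continuous_fderiv_test hφ (EuclideanSpace.single i 1))).memLp_of_hasCompactSupport
      ((hasCompactSupport_fderiv_test hc (EuclideanSpace.single i 1)).comp_left
        (g := fun s : ℝ => (s : ℂ)) (by simp))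
  have k2 : MemLp (fun x => φ x • (EuclideanSpace.single i 1 : EuclideanSpace ℂ (Fin d))) 2
      volume :=
    (hφ.continuous.smul continuous_const).memLp_of_hasCompactSupport hc.smul_right
  have e1 : ∀ w : EuclideanSpace ℝ (Fin d) → ℂ,
      ∫ x, inner ℂ ((fderiv ℝ φ x (EuclideanSpace.single i 1) : ℝ) : ℂ) (w x)
        = ∫ x, (fderiv ℝ φ x (EuclideanSpace.single i 1)) • w x := fun w => by
    simp [mul_comm]
  have e2 : ∀ w : EuclideanSpace ℝ (Fin d) → EuclideanSpace ℂ (Fin d),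
      ∫ x, inner ℂ (φ x • (EuclideanSpace.single i 1 : EuclideanSpace ℂ (Fin d))) (w x)
        = ∫ x, φ x • w x i := fun w => by
    congr 1
    ext x
    rw [RCLike.real_smul_eq_coe_smul (K := ℂ), inner_smul_left, EuclideanSpace.inner_single_left]
    simp
  have l1 := hwv _ k1
  have l2 := (hwh _ k2).neg
  simp_rw [e1] at l1
  simp_rw [e2] at l2
  refine tendsto_nhds_unique l1 (l2.congr fun n => ?_)
  exact ((hv n).2.2 φ hφ hc i).symm

/-- Compactness in `H^1` up to translations: if a bounded sequence carries local masses bounded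
below around the points `y n`, then the translates by `y n` have a nonzero weak limit, and a
subsequence converges to it almost everywhere. -/
theorem exists_weak_limit_ne_zero {d : ℕ} {v : ℕ → EuclideanSpace ℝ (Fin d) → ℂ}
    {h : ℕ → EuclideanSpace ℝ (Fin d) → EuclideanSpace ℂ (Fin d)}
    (hv : ∀ n, HasWeakGradient (v n) (h n)) {M : ℝ≥0} (hM : ∀ n, eLpNorm (v n) 2 ≤ M)
    (hM' : ∀ n, eLpNorm (h n) 2 ≤ M) {A : ℝ≥0∞} (hA : 0 < A)
    (hmass : ∀ n, A ≤ ∫⁻ x, ‖unitBump d x • v n x‖ₑ ^ 2) :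
    ∃ (ns : ℕ → ℕ) (v' : EuclideanSpace ℝ (Fin d) → ℂ)
      (h' : EuclideanSpace ℝ (Fin d) → EuclideanSpace ℂ (Fin d)), StrictMono ns ∧
      HasWeakGradient v' h' ∧ MemLp v' 2 ∧ MemLp h' 2 ∧ ¬ v' =ᵐ[volume] 0 ∧
      WeakTendsto volume (fun n => v (ns n)) v' ∧ WeakTendsto volume (fun n => h (ns n)) h' ∧
      ∀ᵐ x, Tendsto (fun n => v (ns n) x) atTop (𝓝 (v' x)) := by
  have : Fact ((2 : ℝ≥0∞) ≠ ⊤) := ⟨by simp⟩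
  have hvL : ∀ n, MemLp (v n) 2 := fun n =>
    ⟨(hv n).1.aestronglyMeasurable, (hM n).trans_lt (by simp)⟩
  have hhL : ∀ n, MemLp (h n) 2 := fun n =>
    ⟨(hv n).2.1.aestronglyMeasurable, (hM' n).trans_lt (by simp)⟩
  have hMr : ENNReal.ofReal (M : ℝ) = M := by simp
  obtain ⟨v', n1, hv'L, hn1, hw1⟩ := exists_weakTendsto hvL (M := M) (by simpa [hMr] using hM)
  obtain ⟨h', n2, hh'L, hn2, hw2⟩ := exists_weakTendsto (fun n => hhL (n1 n)) (M := M)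
    (by simpa [hMr] using fun n => hM' (n1 n))
  have hw1' := hw1.comp hn2
  have hg : HasWeakGradient v' h' :=
    HasWeakGradient.of_weakTendsto (fun n => hv (n1 (n2 n))) hv'L hh'L hw1' hw2
  have hB : ∃ M' : ℝ≥0, (∀ n, eLpNorm (fun x => v (n1 (n2 n)) x - v' x) 2 ≤ M') ∧
      ∀ n, eLpNorm (fun x => h (n1 (n2 n)) x - h' x) 2 ≤ M' := by
    refine ⟨M + (eLpNorm v' 2).toNNReal + (eLpNorm h' 2).toNNReal, fun n => ?_, fun n => ?_⟩
    · refine (eLpNorm_sub_le (hvL _).1 hv'L.1 (by norm_num)).trans ?_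
      push_cast
      rw [ENNReal.coe_toNNReal hv'L.2.ne]
      exact (add_le_add (hM _) le_rfl).trans le_self_add
    · refine (eLpNorm_sub_le (hhL _).1 hh'L.1 (by norm_num)).trans ?_
      push_cast
      rw [ENNReal.coe_toNNReal hh'L.2.ne]
      exact add_le_add ((hM' _).trans le_self_add) le_rfl
  obtain ⟨M', hB1, hB2⟩ := hB
  have hw3 := hw1'.sub_const (fun n => hvL _) hv'L
  have hd := fun n => (hv (n1 (n2 n))).sub hg
  obtain ⟨n3, hn3, hae⟩ := exists_ae_tendsto_of_weakTendsto hd hB1 hB2 hw3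
  refine ⟨fun n => n1 (n2 (n3 n)), v', h', hn1.comp (hn2.comp hn3), hg, hv'L, hh'L,
    fun h0 => ?_, hw1'.comp hn3,
    hw2.comp hn3, ?_⟩
  · -- with a zero limit, Rellich's theorem on a ball contradicts the lower bound on the masses
    have hfin : IsFiniteMeasure ((volume : Measure (EuclideanSpace ℝ (Fin d))).restrict
        (Metric.ball 0 2)) := ⟨by simpa using measure_ball_lt_top⟩
    have hR := tendsto_lintegral_sq_of_weakTendsto (Measure.restrict_le_self
      (μ := (volume : Measure (EuclideanSpace ℝ (Fin d)))) (s := Metric.ball 0 2)) hd hB1 hB2 hw3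
    refine absurd (ge_of_tendsto hR (Eventually.of_forall fun n => ?_)) (not_le.2 hA)
    refine (hmass (n1 (n2 n))).trans ?_
    rw [← lintegral_indicator Metric.isOpen_ball.measurableSet]
    refine lintegral_mono_ae ?_
    filter_upwards [h0] with x hx
    by_cases hxb : x ∈ Metric.ball (0 : EuclideanSpace ℝ (Fin d)) 2
    · rw [Set.indicator_of_mem hxb, enorm_smul, hx]
      simp only [Pi.zero_apply, sub_zero]
      gcongr
      refine mul_le_of_le_one_left' ?_
      rw [Real.enorm_of_nonneg (unitBump_mem d x).1]
      exact ENNReal.ofReal_le_one.2 (unitBump_mem d x).2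
    · have : unitBump d x = 0 := (unitBump d).zero_of_le_dist (by
        have : (unitBump d).rOut = 2 := rfl
        rw [this]
        simpa using hxb)
      simp [this]
  · filter_upwards [hae] with x hx
    simpa using hx.add_const (v' x)

/-! ### Splitting of the functionals and existence of a minimizer -/

theorem tendsto_normL_rpow_sub {d : ℕ} {r : ℝ} (hr : 1 ≤ r)
    {v : ℕ → EuclideanSpace ℝ (Fin d) → ℂ} {v' : EuclideanSpace ℝ (Fin d) → ℂ}
    (hv : ∀ n, MemLp (v n) (ENNReal.ofReal r)) (hv' : MemLp v' (ENNReal.ofReal r)) {K : ℝ}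
    (hK : ∀ n, normL r (v n) ^ r ≤ K)
    (hlim : ∀ᵐ x, Tendsto (fun n => v n x) atTop (𝓝 (v' x))) :
    Tendsto (fun n => normL r (v n) ^ r - normL r (fun x => v n x - v' x) ^ r) atTop
      (𝓝 (normL r v' ^ r)) := by
  have hr0 : 0 < r := by linarith
  have hd : ∀ n, MemLp (fun x => v n x - v' x) (ENNReal.ofReal r) := fun n => (hv n).sub hv'
  have hb : ∀ n, ∫ x, ‖v n x - v' x‖ ^ r ≤ (K ^ r⁻¹ + normL r v') ^ r := fun n => by
    rw [← normL_rpow hr0 (hd n).1]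
    refine Real.rpow_le_rpow (normL_nonneg _ _) ?_ hr0.le
    have h1 : normL r (fun x => v n x - v' x) ≤ normL r (v n) + normL r v' :=
      lpNorm_sub_le (hv n) (by simpa using hr)
    have h2 : normL r (v n) ≤ K ^ r⁻¹ := by
      have := Real.rpow_le_rpow (Real.rpow_nonneg (normL_nonneg r (v n)) r) (hK n)
        (inv_nonneg.2 hr0.le)
      rwa [← Real.rpow_mul (normL_nonneg _ _), mul_inv_cancel₀ hr0.ne', Real.rpow_one] at this
    linarith
  have key := tendsto_integral_rpow_sub_of_ae hr0 (fun n => integrable_rpow_of_memLp hr0 (hv n))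
    (integrable_rpow_of_memLp hr0 hv') (fun n => integrable_rpow_of_memLp hr0 (hd n)) hb hlim
  rw [← normL_rpow hr0 hv'.1] at key
  refine key.congr fun n => ?_
  rw [normL_rpow hr0 (hv n).1, normL_rpow hr0 (hd n).1]

/-- A bounded minimizing sequence with a nonzero weak limit: the functionals split into the part of
the limit and the part of the remainder, and a limit with `N_ω > 0` would leave a remainder with
`N_ω < 0` of too small an action. -/
theorem isGroundState_of_weak_limit {d : ℕ} (hd : 3 ≤ d) {p ω : ℝ} (hp : 1 < p)
    (hp' : p < ((d : ℝ) + 2) / ((d : ℝ) - 2)) (hω : 0 < ω)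
    {v : ℕ → EuclideanSpace ℝ (Fin d) → ℂ} {v' : EuclideanSpace ℝ (Fin d) → ℂ}
    {h : ℕ → EuclideanSpace ℝ (Fin d) → EuclideanSpace ℂ (Fin d)}
    {h' : EuclideanSpace ℝ (Fin d) → EuclideanSpace ℂ (Fin d)}
    (hv : ∀ n, HasWeakGradient (v n) (h n)) (hvL : ∀ n, MemLp (v n) 2) (hhL : ∀ n, MemLp (h n) 2)
    (hv' : HasWeakGradient v' h') (hvL' : MemLp v' 2) (hhL' : MemLp h' 2)
    (hwv : WeakTendsto volume v v') (hwh : WeakTendsto volume h h')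
    (hlim : ∀ᵐ x, Tendsto (fun n => v n x) atTop (𝓝 (v' x))) (h0 : ¬ v' =ᵐ[volume] 0)
    (hN : ∀ n, nehari p ω (v n) = 0)
    (hred : Tendsto (fun n => reducedAction p (v n)) atTop (𝓝 (mNehari d p ω))) {K : ℝ}
    (hK : ∀ n, gradNorm (v n) ^ 2 + ω * normL 2 (v n) ^ 2 ≤ K) : IsGroundState p ω v' := by
  have hd' : (3 : ℝ) ≤ d := by exact_mod_cast hd
  have hq := two_lt_critExp hd
  have hlt := add_one_lt_critExp hd hp'
  have H1 : ∀ n, MemH1 (v n) := fun n => ⟨hvL n, h n, hv n, hhL n⟩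
  have H1' : MemH1 v' := ⟨hvL', h', hv', hhL'⟩
  have H1d : ∀ n, MemH1 (fun x => v n x - v' x) := fun n =>
    ⟨(hvL n).sub hvL', _, (hv n).sub hv', (hhL n).sub hhL'⟩
  have hs := fun n => ((H1 n).memDotH1 hd).1
  have hs' := (H1'.memDotH1 hd).1
  have hPn := fun n => Real.rpow_nonneg (normL_nonneg (p + 1) (v n)) (p + 1)
  have hQn := fun n => Real.rpow_nonneg (normL_nonneg (critExp d) (v n)) (critExp d)
  have hPQ : ∀ n, normL (p + 1) (v n) ^ (p + 1) + normL (critExp d) (v n) ^ critExp d ≤ K :=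
    fun n => by
      have h1 := hN n
      unfold nehari at h1
      linarith [hK n]
  -- the four terms of the functionals
  have tA : Tendsto (fun n => gradNorm (v n) ^ 2 - gradNorm (fun x => v n x - v' x) ^ 2) atTop
      (𝓝 (gradNorm v' ^ 2)) := by
    have := hwh.tendsto_integral_sq_sub hhL hhL'
    rw [← hv'.gradNorm_sq] at this
    refine this.congr fun n => ?_
    rw [(hv n).gradNorm_sq, ((hv n).sub hv').gradNorm_sq]
  have tL : Tendsto (fun n => normL 2 (v n) ^ 2 - normL 2 (fun x => v n x - v' x) ^ 2) atTop
      (𝓝 (normL 2 v' ^ 2)) := by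
    have := hwv.tendsto_integral_sq_sub hvL hvL'
    rw [← normL_two_sq hvL'.1] at this
    refine this.congr fun n => ?_
    rw [normL_two_sq (hvL n).1, normL_two_sq (H1d n).1.1]
  have tP := tendsto_normL_rpow_sub (r := p + 1) (by linarith)
    (fun n => memLp_of_between (by linarith) hlt (hvL n) (hs n))
    (memLp_of_between (by linarith) hlt hvL' hs') (K := K)
    (fun n => by linarith [hPQ n, hQn n]) hlim
  have tQ := tendsto_normL_rpow_sub (r := critExp d) (by linarith) hs hs' (K := K)
    (fun n => by linarith [hPQ n, hPn n]) hlim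
  have tN : Tendsto (fun n => nehari p ω (fun x => v n x - v' x)) atTop
      (𝓝 (- nehari p ω v')) := by
    have := (((tA.add (tL.const_mul ω)).sub tP).sub tQ).neg
    refine this.congr fun n => ?_
    have h1 := hN n
    unfold nehari at h1 ⊢
    linarith
  have tI : Tendsto (fun n => reducedAction p (fun x => v n x - v' x)) atTop
      (𝓝 (mNehari d p ω - reducedAction p v')) := by
    have := hred.sub ((tP.const_mul (1 / 2 - 1 / (p + 1))).add (tQ.div_const (d : ℝ)))
    refine this.congr fun n => ?_
    unfold reducedAction
    ring
  rcases le_or_gt (nehari p ω v') 0 with hneg | hpos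
  · refine isGroundState_of_le hd hp hω H1' h0 hneg ?_
    have := ge_of_tendsto tI (Eventually.of_forall fun n => reducedAction_nonneg hp _)
    linarith
  · exfalso
    have hev : ∀ᶠ n in atTop, mNehari d p ω ≤ reducedAction p (fun x => v n x - v' x) := by
      filter_upwards [tN.eventually_lt_const (neg_lt_zero.2 hpos)] with n hn
      exact (mNehari_lt_reducedAction hd hp hω (H1d n) hn).le
    have h1 := ge_of_tendsto tI hev
    have h2 : 0 < reducedAction p v' := by
      have h3 : 0 < normL (critExp d) v' := normL_pos (by linarith) hs' h0
      have h4 := normL_nonneg (p + 1) v'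
      have h5 := half_sub_pos hp
      unfold reducedAction
      positivity
    linarith

theorem exists_bound_nehari_sequence {d : ℕ} (hd : 3 ≤ d) {p ω : ℝ} (hp : 1 < p)
    (hp' : p < ((d : ℝ) + 2) / ((d : ℝ) - 2))
    {u : ℕ → EuclideanSpace ℝ (Fin d) → ℂ} (hu : ∀ n, u n ∈ nehariSet d p ω) {m : ℝ}
    (hlim : Tendsto (fun n => action p ω (u n)) atTop (𝓝 m)) :
    ∃ K : ℝ, ∀ n, gradNorm (u n) ^ 2 + ω * normL 2 (u n) ^ 2 ≤ K := by
  obtain ⟨B, hB⟩ := hlim.bddAbove_range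
  refine ⟨B / (1 / 2 - 1 / (p + 1)), fun n => ?_⟩
  rw [le_div_iff₀ (half_sub_pos hp), mul_comm]
  exact (norms_le_of_mem_nehariSet hd hp hp' (hu n)).trans (hB ⟨n, rfl⟩)

theorem eLpNorm_le_of_lpNorm_sq_le {X F : Type*} [MeasurableSpace X] [NormedAddCommGroup F]
    {μ : Measure X} {f : X → F} (hf : MemLp f 2 μ) {K : ℝ} (h : lpNorm f 2 μ ^ 2 ≤ K) :
    eLpNorm f 2 μ ≤ ENNReal.ofReal √K := by
  rw [← ofReal_lpNorm hf]
  exact ENNReal.ofReal_le_ofReal (Real.le_sqrt_of_sq_le h)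

/-- A lower bound for the local masses, from Lions' lemma. -/
theorem exists_local_mass {d : ℕ} (hd : 3 ≤ d) {η : ℝ} (hη : 0 < η) {K : ℝ≥0∞} (hK : K ≠ ⊤) :
    ∃ A : ℝ≥0∞, 0 < A ∧ ∀ (u : EuclideanSpace ℝ (Fin d) → ℂ)
      (g : EuclideanSpace ℝ (Fin d) → EuclideanSpace ℂ (Fin d)), HasWeakGradient u g →
      (∫⁻ x, ‖g x‖ₑ ^ 2) + ∫⁻ x, ‖u x‖ₑ ^ 2 ≤ K →
      MemLp u (ENNReal.ofReal (2 + 4 / (d : ℝ))) → η ≤ ∫ x, ‖u x‖ ^ (2 + 4 / (d : ℝ)) →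
      ∃ y, A ≤ ∫⁻ x, ‖unitBump d (x - y) • u x‖ₑ ^ 2 := by
  obtain ⟨C, hC, hL⟩ := exists_lions hd
  have hd' : (3 : ℝ) ≤ d := by exact_mod_cast hd
  have hlim : Tendsto (fun A : ℝ≥0∞ => C * (A ^ (2 / (d : ℝ)) * K)) (𝓝 0) (𝓝 0) := by
    have h1 : Tendsto (fun A : ℝ≥0∞ => A ^ (2 / (d : ℝ))) (𝓝 0) (𝓝 0) := by
      have := (ENNReal.continuous_rpow_const (y := 2 / (d : ℝ))).tendsto 0
      rwa [ENNReal.zero_rpow_of_pos (by positivity)] at this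
    have h2 := ENNReal.Tendsto.const_mul (a := C)
      (ENNReal.Tendsto.mul_const h1 (b := K) (Or.inr hK)) (Or.inr hC)
    simpa using h2
  have hev := (hlim.eventually_lt_const (ENNReal.ofReal_pos.2 hη)).filter_mono
    (nhdsWithin_le_nhds (s := Set.Ioi 0))
  obtain ⟨A, hA, hA0⟩ := (hev.and self_mem_nhdsWithin).exists
  refine ⟨A, hA0, fun u g hu hK' hq hη' => ?_⟩
  by_contra hcon
  push Not at hcon
  have h1 := hL u g hu A fun y => (hcon y).le
  have h2 : ENNReal.ofReal η ≤ ∫⁻ x, ‖u x‖ₑ ^ (2 + 4 / (d : ℝ)) := by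
    have hi := integrable_rpow_of_memLp (by positivity) hq
    refine (ENNReal.ofReal_le_ofReal hη').trans (le_of_eq ?_)
    rw [ofReal_integral_eq_lintegral_ofReal hi (Eventually.of_forall fun x => by positivity)]
    congr 1
    ext x
    rw [← ENNReal.ofReal_rpow_of_nonneg (norm_nonneg _) (by positivity), ofReal_norm]
  refine absurd (h2.trans (h1.trans ?_)) (not_le.2 hA)
  gcongr

/-- Existence of a ground state below the critical level. -/
theorem exists_isGroundState {d : ℕ} (hd : 3 ≤ d) {p ω : ℝ} (hp : 1 < p)
    (hp' : p < ((d : ℝ) + 2) / ((d : ℝ) - 2)) (hω : 0 < ω) (hm : mNehari d p ω < mInfty d) :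
    ∃ u : EuclideanSpace ℝ (Fin d) → ℂ, IsGroundState p ω u := by
  have hd' : (3 : ℝ) ≤ d := by exact_mod_cast hd
  have hlt := add_one_lt_critExp hd hp'
  -- a minimizing sequence whose subcritical norms stay away from zero
  obtain ⟨a, -, ha, haS⟩ := exists_seq_tendsto_sInf
    ((nehariSet_nonempty hd hp hω).image (action p ω)) (bddBelow_action hd hp ω)
  choose u₀ hu₀ hua₀ using haS
  have hlim₀ : Tendsto (fun n => action p ω (u₀ n)) atTop (𝓝 (mNehari d p ω)) := by
    simp_rw [hua₀]
    exact ha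
  obtain ⟨δ, hδ, hfr⟩ := exists_frequently_normL_ge hd hp hp' hω hm hu₀ hlim₀
  obtain ⟨ns, hns, hδn⟩ := extraction_of_frequently_atTop hfr
  set u := fun n => u₀ (ns n) with hudef
  have hu : ∀ n, u n ∈ nehariSet d p ω := fun n => hu₀ _
  have hlim : Tendsto (fun n => action p ω (u n)) atTop (𝓝 (mNehari d p ω)) :=
    hlim₀.comp hns.tendsto_atTop
  obtain ⟨K, hK⟩ := exists_bound_nehari_sequence hd hp hp' hu hlim
  have huL : ∀ n, MemLp (u n) 2 := fun n => (hu n).1.1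
  choose g hg hgL using fun n => (hu n).1.2
  have hs := fun n => ((hu n).1.memDotH1 hd).1
  have hA0 : ∀ n, 0 ≤ ω * normL 2 (u n) ^ 2 := fun n => by positivity
  have hKA : ∀ n, gradNorm (u n) ^ 2 ≤ K := fun n => by linarith [hK n, hA0 n]
  have hKL : ∀ n, normL 2 (u n) ^ 2 ≤ K / ω := fun n => by
    rw [le_div_iff₀ hω]
    nlinarith [hK n, sq_nonneg (gradNorm (u n))]
  have hK0 : 0 ≤ K := (sq_nonneg _).trans (hKA 0)
  have hKQ : ∀ n, normL (critExp d) (u n) ^ critExp d ≤ K := fun n => by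
    have h1 := (hu n).2.2
    have h2 := Real.rpow_nonneg (normL_nonneg (p + 1) (u n)) (p + 1)
    unfold nehari at h1
    linarith [hK n]
  set M : ℝ≥0 := (√K).toNNReal + (√(K / ω)).toNNReal with hM
  have hMu : ∀ n, eLpNorm (u n) 2 ≤ M := fun n => by
    have h1 := hKL n
    unfold normL at h1
    rw [ENNReal.ofReal_ofNat] at h1
    refine (eLpNorm_le_of_lpNorm_sq_le (huL n) h1).trans ?_
    rw [hM]
    push_cast
    exact le_add_self
  have hMg : ∀ n, eLpNorm (g n) 2 ≤ M := fun n => by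
    have h1 := hKA n
    rw [(hg n).gradNorm_eq] at h1
    refine (eLpNorm_le_of_lpNorm_sq_le (hgL n) h1).trans ?_
    rw [hM]
    push_cast
    exact le_self_add
  -- local masses bounded below, by Lions' lemma
  have hq2 : 2 < 2 + 4 / (d : ℝ) := by
    have : 0 < 4 / (d : ℝ) := by positivity
    linarith
  have hqs : 2 + 4 / (d : ℝ) < critExp d := by
    unfold critExp
    rw [lt_div_iff₀ (by linarith)]
    have : (2 + 4 / (d : ℝ)) * (d - 2) = 2 * d - 8 / d := by
      field_simp
      ring
    rw [this]
    have : 0 < 8 / (d : ℝ) := by positivity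
    linarith
  obtain ⟨η, hη, hηu⟩ := exists_le_integral_rpow (d := d) (by linarith : 2 < p + 1) hlt hq2 hqs hδ
    (K := K / ω + K) (by positivity)
  obtain ⟨A, hA, hAu⟩ := exists_local_mass hd hη (K := (M : ℝ≥0∞) ^ 2 + (M : ℝ≥0∞) ^ 2) (by simp)
  have hy : ∀ n, ∃ y, A ≤ ∫⁻ x, ‖unitBump d (x - y) • u n x‖ₑ ^ 2 := fun n => by
    refine hAu (u n) (g n) (hg n) ?_ (memLp_of_between hq2 hqs (huL n) (hs n))
      (hηu (u n) (huL n) (hs n) (add_le_add (hKL n) (hKQ n)) (hδn n))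
    rw [← eLpNorm_two_sq, ← eLpNorm_two_sq]
    exact add_le_add (pow_le_pow_left' (hMg n) 2) (pow_le_pow_left' (hMu n) 2)
  choose y hy using hy
  -- translate the masses to the origin and pass to the weak limit
  have hvg := fun n => (hg n).comp_add_right (y n)
  have hvL := fun n => memLp_comp_add_right (huL n) (y n)
  have hgvL := fun n => memLp_comp_add_right (hgL n) (y n)
  obtain ⟨ks, v', h', hks, hv', hvL', hhL', hne, hw1, hw2, hae⟩ := exists_weak_limit_ne_zero hvg
    (M := M)
    (fun n => (eLpNorm_comp_add_right 2 (huL n).1 (y n)).trans_le (hMu n))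
    (fun n => (eLpNorm_comp_add_right 2 (hgL n).1 (y n)).trans_le (hMg n)) hA (fun n => by
      refine (hy n).trans (le_of_eq ?_)
      rw [← lintegral_add_right_eq_self _ (y n)]
      simp)
  have htr := fun n => (hu n).1.functionals_comp_add_right p ω (y n)
  refine ⟨v', isGroundState_of_weak_limit hd hp hp' hω (fun n => hvg (ks n))
    (fun n => hvL (ks n)) (fun n => hgvL (ks n)) hv' hvL' hhL' hw1 hw2 hae hne (fun n => ?_) ?_
    (K := K) fun n => ?_⟩
  · rw [(htr (ks n)).1]
    exact (hu (ks n)).2.2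
  · refine (hlim.comp hks.tendsto_atTop).congr fun n => ?_
    rw [(htr (ks n)).2, Function.comp_apply, action_eq hd, (hu (ks n)).2.2]
    simp
  · have h1 := hK (ks n)
    have e1 : normL 2 (fun x => u (ks n) (x + y (ks n))) = normL 2 (u (ks n)) :=
      lpNorm_comp_add_right _ (huL (ks n)).1 _
    rw [(hvg (ks n)).gradNorm_eq, lpNorm_comp_add_right _ (hgL (ks n)).1, e1,
      ← (hg (ks n)).gradNorm_eq]
    exact h1

end CriticalScalarField

end

theorem proposition1p1 (d : ℕ) (hd : 3 ≤ d) (p : ℝ) (hp₁ : 1 < p)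
    (hp₂ : p < ((d : ℝ) + 2) / ((d : ℝ) - 2)) :
    CriticalScalarField.mInfty d = CriticalScalarField.sobolevConst d ^ ((d : ℝ) / 2) / (d : ℝ) ∧
    ∀ ω : ℝ, 0 < ω →
      CriticalScalarField.mNehari d p ω < CriticalScalarField.mInfty d →
      ∃ u : EuclideanSpace ℝ (Fin d) → ℂ, CriticalScalarField.IsGroundState p ω u :=
  ⟨CriticalScalarField.mInfty_eq hd, fun _ hω hm =>
    CriticalScalarField.exists_isGroundState hd hp₁ hp₂ hω hm⟩
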